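/- **Proposition 1.2.** Let $m\ge 2$ be an integer and $\mathbb T^2=(\mathbb R/2\pi\mathbb Z)^2$. For $s<0$ let $\mu$ be the massive Gaussian free field on $H^s(\mathbb T^2)$, i.e. the law of the random Fourier series $$u(x)=\sum_{n\in\mathbb Z^2}\frac{g_n}{\sqrt{1+|n|^2}}\,e^{in\cdot x},$$ where $(g_n)_{n\in\mathbb Z^2}$ are independent standard complex Gaussian random variables (mean $0$, $\mathbb E|g_n|^2=1$, independent real and imaginary parts of variance $\tfrac12$). For $N\in\mathbb N$ put $$u_N=\mathbf P_Nu=\sum_{|n|\le N}\widehat u(n)e^{in\cdot x},\qquad \sigma_N=\sum_{|n|\le N}\frac1{1+|n|^2},$$ $$:\!|u_N|^{2m}\!:\;=\sum_{\ell=0}^m\binom m\ell H_{2\ell}\big(\mathrm{Re}\,u_N;\tfrac{\sigma_N}2\big)H_{2m-2\ell}\big(\mathrm{Im}\,u_N;\tfrac{\sigma_N}2\big),$$ where the Hermite polynomials $H_k(x;\sigma)$ are defined by $e^{tx-\frac12\sigma t^2}=\sum_{k\ge0}\frac{t^k}{k!}H_k(x;\sigma)$, and let $$G_N(u)=\frac1{2m}\int_{\mathbb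 T^2}:\!|u_N|^{2m}\!:\,dx,\qquad R_N(u)=e^{-G_N(u)}.$$ Then: 1. For each $1\le p<\infty$ there is a constant $C<\infty$, depending only on $m$ and $p$, such that $R_N\in L^p(\mu)$ and $\|R_N\|_{L^p(\mu)}\le C$ for all $N$ (and all $s<0$). 2. For each $s<0$ there is a function $R$ on $H^s(\mathbb T^2)$, independent of $p$, such that for every $1\le p<\infty$ one has $R\in L^p(\mu)$ and $R_N\to R$ in $L^p(\mu)$ as $N\to\infty$. Moreover $R\ge0$ $\mu$-almost surely and $Z=\int R\,d\mu\in(0,\infty)$, so that $dP^{(2m)}_2=Z^{-1}R\,d\mu$ defines a probability measure on $H^s(\mathbb T^2)$ (the Gibbs measure). -/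

import Mathlib

open MeasureTheory ProbabilityTheory Filter Topology
open scoped ENNReal NNReal

noncomputable section

namespace WickNLS

/-! ### The torus, frequencies, and the Sobolev spaces -/

instance factTwoPiPos : Fact (0 < 2 * Real.pi) := ⟨Real.two_pi_pos⟩

/-- The torus `𝕋² = (ℝ / 2πℤ)²`. Its `volume` is Lebesgue measure `dx`, of total mass `(2π)²`. -/
abbrev Torus : Type := AddCircle (2 * Real.pi) × AddCircle (2 * Real.pi)

/-- Frequencies `n ∈ ℤ²`. -/
abbrev Freq : Type := ℤ × ℤ

/-- The character `e_n(x) = exp (i n · x)`. -/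
def expChar (n : Freq) (x : Torus) : ℂ := fourier n.1 x.1 * fourier n.2 x.2

/-- The Japanese bracket `⟨n⟩ = (1 + |n|²)^{1/2}`, with `|n|` the Euclidean norm. -/
def bracket (n : Freq) : ℝ := √(1 + (n.1 : ℝ) ^ 2 + (n.2 : ℝ) ^ 2)

theorem bracket_pos (n : Freq) : 0 < bracket n := Real.sqrt_pos.2 (by positivity)

/-- The Sobolev space `H^s(𝕋²)`. A periodic distribution `u` is identified with the family of its
Fourier coefficients `û(n)`, and `u ∈ H^s` means that `n ↦ ⟨n⟩^s û(n)` is square summable.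
The underlying element of `ℓ²(ℤ²)` is this weighted family; see `coeff` for `û` itself, and
`norm_sq_eq`, `coeff_ofCoeff`, `coeff_injective` for the norm and the identification. -/
def Sobolev (_s : ℝ) : Type := lp (fun _ : Freq => ℂ) 2

instance (s : ℝ) : NormedAddCommGroup (Sobolev s) :=
  inferInstanceAs (NormedAddCommGroup (lp (fun _ : Freq => ℂ) 2))

instance (s : ℝ) : InnerProductSpace ℂ (Sobolev s) :=
  inferInstanceAs (InnerProductSpace ℂ (lp (fun _ : Freq => ℂ) 2))

instance (s : ℝ) : CompleteSpace (Sobolev s) :=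
  inferInstanceAs (CompleteSpace (lp (fun _ : Freq => ℂ) 2))

/-- `H^s(𝕋²)` carries the Borel σ-algebra of its norm. -/
instance (s : ℝ) : MeasurableSpace (Sobolev s) := borel _

instance (s : ℝ) : BorelSpace (Sobolev s) := ⟨rfl⟩

/-- The weighted family `n ↦ ⟨n⟩^s û(n)`, as an element of `ℓ²(ℤ²)`. -/
def Sobolev.weighted {s : ℝ} (u : Sobolev s) : lp (fun _ : Freq => ℂ) 2 := u

/-- The element of `H^s(𝕋²)` with a given weighted family of coefficients. -/
def Sobolev.ofWeighted {s : ℝ} (v : lp (fun _ : Freq => ℂ) 2) : Sobolev s := v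

/-- The `n`-th Fourier coefficient `û(n)` of `u ∈ H^s(𝕋²)`. -/
def Sobolev.coeff {s : ℝ} (u : Sobolev s) (n : Freq) : ℂ :=
  ((bracket n ^ (-s) : ℝ) : ℂ) * u.weighted n

/-- `‖u‖²_{H^s} = ∑ ⟨n⟩^{2s} |û(n)|²`. -/
theorem Sobolev.norm_sq_eq {s : ℝ} (u : Sobolev s) :
    HasSum (fun n => bracket n ^ (2 * s) * ‖u.coeff n‖ ^ 2) (‖u‖ ^ 2) := by
  have h := lp.hasSum_norm (p := 2) (by norm_num) u.weighted
  simp only [ENNReal.toReal_ofNat, Real.rpow_ofNat] at h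
  convert! h using 2 with n
  have hb := bracket_pos n
  rw [Sobolev.coeff, norm_mul, Complex.norm_real, Real.norm_of_nonneg (by positivity), mul_pow,
    ← mul_assoc, ← Real.rpow_natCast (bracket n ^ (-s)), ← Real.rpow_mul hb.le,
    ← Real.rpow_add hb,
    show 2 * s + -s * ((2 : ℕ) : ℝ) = 0 by push_cast; ring, Real.rpow_zero, one_mul]

theorem Sobolev.coeff_injective (s : ℝ) :
    Function.Injective (Sobolev.coeff : Sobolev s → Freq → ℂ) := by
  intro u v h
  refine lp.ext (funext fun n => ?_)
  have h1 := congrFun h n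
  have hb : ((bracket n ^ (-s) : ℝ) : ℂ) ≠ 0 := by
    exact_mod_cast (Real.rpow_pos_of_pos (bracket_pos n) _).ne'
  exact mul_left_cancel₀ hb h1

/-- `a` is the family of Fourier coefficients of an element of `H^s(𝕋²)`. -/
def IsSobolevCoeff (s : ℝ) (a : Freq → ℂ) : Prop :=
  Summable fun n => bracket n ^ (2 * s) * ‖a n‖ ^ 2

theorem memlp_weighted {s : ℝ} {a : Freq → ℂ} (h : IsSobolevCoeff s a) :
    Memℓp (fun n => ((bracket n ^ s : ℝ) : ℂ) * a n) 2 := by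
  refine memℓp_gen ?_
  refine Summable.congr h fun n => ?_
  have hb := bracket_pos n
  simp only [ENNReal.toReal_ofNat, Real.rpow_ofNat]
  rw [norm_mul, Complex.norm_real, Real.norm_of_nonneg (by positivity), mul_pow,
    ← Real.rpow_natCast (bracket n ^ s), ← Real.rpow_mul hb.le]
  norm_num [mul_comm]

open Classical in
/-- The Fourier series `∑ a(n) e^{in·x}` as an element of `H^s(𝕋²)` (and `0` if it is not one). -/
def Sobolev.ofCoeff (s : ℝ) (a : Freq → ℂ) : Sobolev s :=
  if h : IsSobolevCoeff s a then
    Sobolev.ofWeighted ⟨fun n => ((bracket n ^ s : ℝ) : ℂ) * a n, memlp_weighted h⟩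
  else 0

theorem Sobolev.coeff_ofCoeff {s : ℝ} {a : Freq → ℂ} (h : IsSobolevCoeff s a) :
    (Sobolev.ofCoeff s a).coeff = a := by
  funext n
  unfold Sobolev.ofCoeff
  simp only [h, ↓reduceDIte]
  change ((bracket n ^ (-s) : ℝ) : ℂ) * (((bracket n ^ s : ℝ) : ℂ) * a n) = a n
  rw [← mul_assoc, ← Complex.ofReal_mul, ← Real.rpow_add (bracket_pos n)]
  simp

/-! ### The Gaussian free field -/

/-- The law of a standard complex Gaussian `g`: mean `0`, `𝔼|g|² = 1`, with independent real and
imaginary parts of variance `1/2`. -/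
def stdComplexGaussian : Measure ℂ :=
  ((gaussianReal 0 (1 / 2)).prod (gaussianReal 0 (1 / 2))).map fun p => (⟨p.1, p.2⟩ : ℂ)

/-- The law of a family `(g_n)_{n ∈ ℤ²}` of independent standard complex Gaussians. -/
def gaussianFamily : Measure (Freq → ℂ) := Measure.infinitePi fun _ => stdComplexGaussian

/-- The random Fourier series `u = ∑ g_n / √(1 + |n|²) e^{in·x}`. -/
def randomSeries (s : ℝ) (g : Freq → ℂ) : Sobolev s :=
  Sobolev.ofCoeff s fun n => g n / (bracket n : ℂ)

/-- The massive Gaussian free field `μ`, as a measure on `H^s(𝕋²)`: the law of `randomSeries`. -/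
def gff (s : ℝ) : Measure (Sobolev s) := gaussianFamily.map (randomSeries s)

/-! The series converges in `H^s(𝕋²)` almost surely for `s < 0`, so `gff s` is a probability
measure under which the Fourier coefficients have the prescribed joint law. -/

instance : IsProbabilityMeasure stdComplexGaussian :=
  Measure.isProbabilityMeasure_map (by
    refine Measurable.aemeasurable ?_
    exact Complex.measurableEquivRealProd.symm.measurable)

instance : IsProbabilityMeasure gaussianFamily := by
  unfold gaussianFamily; infer_instance

theorem lintegral_stdComplexGaussian :
    ∫⁻ z, ENNReal.ofReal (‖z‖ ^ 2) ∂stdComplexGaussian = 1 := by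
  have hm : Measurable fun p : ℝ × ℝ => (⟨p.1, p.2⟩ : ℂ) :=
    Complex.measurableEquivRealProd.symm.measurable
  have h2 : ∫⁻ x, ENNReal.ofReal (x ^ 2) ∂(gaussianReal 0 (1 / 2)) = 1 / 2 := by
    have hi : Integrable (fun x : ℝ => x ^ 2) (gaussianReal 0 (1 / 2)) :=
      (memLp_id_gaussianReal (μ := 0) (v := 1 / 2) 2).integrable_sq
    rw [← ofReal_integral_eq_lintegral_ofReal hi (ae_of_all _ fun x => sq_nonneg x)]
    have hv := variance_fun_id_gaussianReal (μ := 0) (v := 1 / 2)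
    rw [variance_eq_integral (by fun_prop)] at hv
    simp only [integral_id_gaussianReal, sub_zero] at hv
    rw [hv]
    simp
  rw [stdComplexGaussian, lintegral_map (by fun_prop) hm]
  have : ∀ p : ℝ × ℝ, ENNReal.ofReal (‖(⟨p.1, p.2⟩ : ℂ)‖ ^ 2)
      = ENNReal.ofReal (p.1 ^ 2) + ENNReal.ofReal (p.2 ^ 2) := by
    intro p
    rw [← ENNReal.ofReal_add (sq_nonneg _) (sq_nonneg _), ← Complex.normSq_eq_norm_sq,
      Complex.normSq_mk]
    ring_nf
  simp_rw [this]
  rw [lintegral_add_left (by fun_prop), lintegral_prod _ (by fun_prop),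
    lintegral_prod _ (by fun_prop)]
  have h3 : ∀ x : ℝ≥0∞, x * gaussianReal 0 (1 / 2) Set.univ = x := fun x => by
    rw [measure_univ, mul_one]
  simp only [lintegral_const, h3, h2]
  simp only [one_div]
  exact ENNReal.inv_two_add_inv_two

theorem summable_bracket {r : ℝ} (hr : r < -2) : Summable fun n : Freq => bracket n ^ r := by
  have h := EisensteinSeries.summable_one_div_norm_rpow (k := -r) (by linarith)
  rw [← (finTwoArrowEquiv ℤ).symm.summable_iff] at h
  refine Summable.of_norm_bounded_eventually h ?_
  filter_upwards [(Set.finite_singleton (0 : Freq)).compl_mem_cofinite] with n hn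
  have hb := bracket_pos n
  rw [Real.norm_of_nonneg (by positivity)]
  simp only [Function.comp_apply, neg_neg]
  have hx : (finTwoArrowEquiv ℤ).symm n ≠ 0 := by
    intro h0
    apply hn
    have := congrArg (finTwoArrowEquiv ℤ) h0
    exact this.trans rfl
  refine Real.rpow_le_rpow_of_nonpos (norm_pos_iff.2 hx) ?_ (by linarith)
  refine (pi_norm_le_iff_of_nonneg hb.le).2 fun i => ?_
  rw [Int.norm_eq_abs]
  refine Real.le_sqrt_of_sq_le ?_
  rw [sq_abs]
  fin_cases i
  · change (n.1 : ℝ) ^ 2 ≤ _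
    nlinarith [sq_nonneg (n.2 : ℝ)]
  · change (n.2 : ℝ) ^ 2 ≤ _
    nlinarith [sq_nonneg (n.1 : ℝ)]

theorem ae_isSobolevCoeff {s : ℝ} (hs : s < 0) :
    ∀ᵐ g ∂gaussianFamily, IsSobolevCoeff s fun n => g n / (bracket n : ℂ) := by
  have hb := bracket_pos
  have key : ∀ (g : Freq → ℂ) (n : Freq), bracket n ^ (2 * s) * ‖g n / (bracket n : ℂ)‖ ^ 2
      = bracket n ^ (2 * s - 2) * ‖g n‖ ^ 2 := by
    intro g n
    rw [norm_div, Complex.norm_real, Real.norm_of_nonneg (hb n).le, Real.rpow_sub (hb n)]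
    norm_num
    ring
  have hmeas : ∀ n : Freq, Measurable fun g : Freq → ℂ =>
      ENNReal.ofReal (bracket n ^ (2 * s - 2) * ‖g n‖ ^ 2) := fun n => by fun_prop
  have hfin : ∫⁻ g, ∑' n : Freq, ENNReal.ofReal (bracket n ^ (2 * s - 2) * ‖g n‖ ^ 2)
      ∂gaussianFamily ≠ ∞ := by
    rw [lintegral_tsum fun n => (hmeas n).aemeasurable]
    have : ∀ n : Freq, ∫⁻ g, ENNReal.ofReal (bracket n ^ (2 * s - 2) * ‖g n‖ ^ 2) ∂gaussianFamily
        = ENNReal.ofReal (bracket n ^ (2 * s - 2)) := by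
      intro n
      simp_rw [ENNReal.ofReal_mul (Real.rpow_nonneg (hb n).le (2 * s - 2))]
      rw [lintegral_const_mul _ (by fun_prop)]
      have h1 := (measurePreserving_eval_infinitePi (fun _ : Freq => stdComplexGaussian)
        n).lintegral_comp (f := fun z : ℂ => ENNReal.ofReal (‖z‖ ^ 2)) (by fun_prop)
      rw [lintegral_stdComplexGaussian] at h1
      rw [gaussianFamily]
      simp only [Function.eval] at h1
      rw [h1, mul_one]
    simp_rw [this]
    exact (summable_bracket (r := 2 * s - 2) (by linarith)).tsum_ofReal_ne_top
  filter_upwards [ae_lt_top (Measurable.tsum hmeas) hfin] with g hg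
  unfold IsSobolevCoeff
  simp_rw [key]
  have h := ENNReal.summable_toReal hg.ne
  refine h.congr fun n => ?_
  have := hb n
  rw [ENNReal.toReal_ofReal (by positivity)]

theorem continuous_coeff (s : ℝ) (n : Freq) : Continuous fun u : Sobolev s => u.coeff n :=
  continuous_const.mul
    (lp.evalCLM ℂ (fun _ : Freq => ℂ) 2 n).continuous

theorem measurable_randomSeries (s : ℝ) : Measurable (randomSeries s) := by
  classical
  have hS : MeasurableSet {g : Freq → ℂ | IsSobolevCoeff s fun n => g n / (bracket n : ℂ)} := by
    have : {g : Freq → ℂ | IsSobolevCoeff s fun n => g n / (bracket n : ℂ)} =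
        {g | ∑' n, ENNReal.ofReal (bracket n ^ (2 * s) * ‖g n / (bracket n : ℂ)‖ ^ 2) ≠ ∞} := by
      ext g
      simp only [Set.mem_ofPred_eq, IsSobolevCoeff]
      refine ⟨fun h => h.tsum_ofReal_ne_top, fun h => ?_⟩
      refine (ENNReal.summable_toReal h).congr fun n => ?_
      have := bracket_pos n
      rw [ENNReal.toReal_ofReal (by positivity)]
    rw [this]
    refine (measurableSet_singleton ∞).compl.preimage ?_
    fun_prop
  let F : Finset Freq → (Freq → ℂ) → lp (fun _ : Freq => ℂ) 2 := fun A g =>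
    ∑ n ∈ A, lp.single 2 n (((bracket n ^ s : ℝ) : ℂ) * (g n / (bracket n : ℂ)))
  have hF : ∀ A, Continuous (F A) := fun A =>
    continuous_finsetSum _ fun n _ => (lp.isometry_single n).continuous.comp (by fun_prop)
  refine measurable_of_tendsto_metrizable' (β := Sobolev s) atTop
    (f := fun A : Finset Freq => {g : Freq → ℂ | IsSobolevCoeff s fun n =>
      g n / (bracket n : ℂ)}.indicator fun g => (Sobolev.ofWeighted (F A g) : Sobolev s)) ?_ ?_
  · intro A
    refine Measurable.indicator ?_ hS
    have : Continuous fun g => (Sobolev.ofWeighted (F A g) : Sobolev s) := hF A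
    exact this.measurable
  · rw [tendsto_pi_nhds]
    intro g
    by_cases hg : IsSobolevCoeff s fun n => g n / (bracket n : ℂ)
    · have h1 : randomSeries s g = Sobolev.ofWeighted ⟨_, memlp_weighted hg⟩ := by
        unfold randomSeries Sobolev.ofCoeff
        simp only [hg, ↓reduceDIte]
      rw [h1]
      simp only [Set.indicator, Set.mem_ofPred_eq, hg, ↓reduceIte]
      exact lp.hasSum_single (p := 2) (by norm_num)
        (⟨_, memlp_weighted hg⟩ : lp (fun _ : Freq => ℂ) 2)
    · have h1 : randomSeries s g = 0 := by
        unfold randomSeries Sobolev.ofCoeff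
        simp only [hg, ↓reduceDIte]
      rw [h1]
      simp only [Set.indicator, Set.mem_ofPred_eq, hg, ↓reduceIte]
      exact tendsto_const_nhds

instance (s : ℝ) : IsProbabilityMeasure (gff s) :=
  Measure.isProbabilityMeasure_map (measurable_randomSeries s).aemeasurable

/-- For `s < 0`, the joint law of all Fourier coefficients under `gff s` is that of
`(g_n / √(1 + |n|²))_n`. -/
theorem map_coeff_gff {s : ℝ} (hs : s < 0) :
    (gff s).map Sobolev.coeff = gaussianFamily.map fun g n => g n / (bracket n : ℂ) := by
  have hc : Measurable (Sobolev.coeff : Sobolev s → Freq → ℂ) :=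
    measurable_pi_lambda _ fun n => (continuous_coeff s n).measurable
  rw [gff, Measure.map_map hc (measurable_randomSeries s)]
  refine Measure.map_congr ?_
  filter_upwards [ae_isSobolevCoeff hs] with g hg
  exact Sobolev.coeff_ofCoeff hg

/-! ### Wick powers, the renormalized potential energy, and the Gibbs measure -/

/-- The frequencies `|n| ≤ N`. -/
def freqBall (N : ℕ) : Finset Freq :=
  (Finset.Icc (-(N : ℤ)) N ×ˢ Finset.Icc (-(N : ℤ)) N).filter
    fun n => n.1 ^ 2 + n.2 ^ 2 ≤ (N : ℤ) ^ 2

theorem mem_freqBall (N : ℕ) (n : Freq) :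
    n ∈ freqBall N ↔ √((n.1 : ℝ) ^ 2 + (n.2 : ℝ) ^ 2) ≤ N := by
  rw [Real.sqrt_le_left (by positivity), freqBall, Finset.mem_filter, Finset.mem_product,
    Finset.mem_Icc, Finset.mem_Icc]
  constructor
  · rintro ⟨-, h⟩
    exact_mod_cast h
  · intro h
    have h' : n.1 ^ 2 + n.2 ^ 2 ≤ (N : ℤ) ^ 2 := by exact_mod_cast h
    have h1 := abs_le.1 (abs_le_of_sq_le_sq (a := n.1) (b := (N : ℤ))
      (by nlinarith [sq_nonneg n.2]) (by positivity))
    have h2 := abs_le.1 (abs_le_of_sq_le_sq (a := n.2) (b := (N : ℤ))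
      (by nlinarith [sq_nonneg n.1]) (by positivity))
    exact ⟨⟨h1, h2⟩, h'⟩

/-- `σ_N = ∑_{|n| ≤ N} 1 / (1 + |n|²)`. -/
def sigma (N : ℕ) : ℝ := ∑ n ∈ freqBall N, 1 / (1 + (n.1 : ℝ) ^ 2 + (n.2 : ℝ) ^ 2)

/-- The Dirichlet projection `u_N = P_N u = ∑_{|n| ≤ N} û(n) e^{in·x}`. -/
def proj {s : ℝ} (N : ℕ) (u : Sobolev s) (x : Torus) : ℂ :=
  ∑ n ∈ freqBall N, u.coeff n * expChar n x

/-- The Hermite polynomial `H_k(x; v) = v^{k/2} H_k(v^{-1/2} x)` with variance parameter `v > 0`,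
where `H_k` is the probabilists' Hermite polynomial, `e^{tx - v t²/2} = ∑ t^k / k! H_k(x; v)`. -/
def hermiteVar (k : ℕ) (v x : ℝ) : ℝ :=
  √v ^ k * Polynomial.aeval (x / √v) (Polynomial.hermite k)

/-- The Wick ordered monomial `:|u_N|^{2m}:` at `x`, obtained by expanding
`((Re u_N)² + (Im u_N)²)^m` and Wick ordering the powers of the real and of the imaginary part,
each of which has variance `σ_N / 2`. -/
def wickPower {s : ℝ} (m N : ℕ) (u : Sobolev s) (x : Torus) : ℝ :=
  ∑ l ∈ Finset.range (m + 1), (m.choose l : ℝ) *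
    (hermiteVar (2 * l) (sigma N / 2) (proj N u x).re *
      hermiteVar (2 * (m - l)) (sigma N / 2) (proj N u x).im)

/-- `G_N(u) = (1 / 2m) ∫_{𝕋²} :|P_N u|^{2m}: dx`. -/
def wickEnergy {s : ℝ} (m N : ℕ) (u : Sobolev s) : ℝ :=
  1 / (2 * (m : ℝ)) * ∫ x : Torus, wickPower m N u x

/-- `R_N(u) = exp (-G_N(u))`. -/
def density {s : ℝ} (m N : ℕ) (u : Sobolev s) : ℝ := Real.exp (-wickEnergy m N u)

/-- The measure `Z⁻¹ R dμ` with `Z = ∫ R dμ`, where `μ` is the Gaussian free field. -/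
def gibbs {s : ℝ} (R : Sobolev s → ℝ) : Measure (Sobolev s) :=
  (ENNReal.ofReal (∫ u, R u ∂(gff s)))⁻¹ • (gff s).withDensity fun u => ENNReal.ofReal (R u)

end WickNLS

end

noncomputable section

namespace WickNLS

/-! ### The standard complex Gaussian -/

/-! The argument is Nelson's, with hypercontractivity replaced by an explicit computation. A Hermite
polynomial is a Gaussian average, H_k(x; v) = E (x + i√v Y)^k, so the Wick power of the truncated
field w is the average over an independent copy w' of ((w + i w')(w̄ + i w̄'))^m
(`wickPoly_field_eq_integral`). Both factors are linear in the variables ζ = Re g + i Re g' and Im g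
+ i Im g', which are again independent standard complex Gaussians, and no conjugate of ζ occurs
(`chaos_expansion`). Hence G_N is the conditional expectation given g of a holomorphic homogeneous
polynomial of degree 2m in ζ.

For such polynomials the second moment is at most the factorial of the degree times the sum of the
squared coefficients. A k-th power is again of this type, so all even moments are bounded as well
(`HasGaussianMoments.lintegral_pow_le`). By Jensen the bounds pass to G_N - G_M, whose coefficients
have square sum O(1/M): integration over the torus forces zero total frequency, and some frequency
exceeds M (`exists_sum_energyCoeff_sub_sq_le`).

The Wick power is bounded below by a multiple of -σ_N^m, and σ_N grows slower than any power, so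
-G_M ≤ C (M+1)^(1/(8m)) pointwise (`exists_neg_le_energy`). With M = j^(4m), the event -G_N ≥ j then
forces |G_N - G_M| ≥ j/2, and Chebyshev with exponent 2j gives probability at most C^j / j!
(`exists_measure_le_neg_energy_le`). This bounds exp(-G_N) in every L^p. Together with the L^p
Cauchy property of G_N and Hölder it gives convergence of exp(-G_N), with limit exp(-G) for an
almost everywhere subsequential limit G. All of this takes place on the Gaussian modes, and
`measurePreserving_modes_gff` carries it to every H^s. -/

theorem measurable_complexMk : Measurable fun p : ℝ × ℝ => (⟨p.1, p.2⟩ : ℂ) :=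
  Complex.measurableEquivRealProd.symm.measurable

/-- The two real densities of variance 1/2 multiply to a radial function, from which rotation
invariance and the absolute moments follow. -/
theorem integral_stdComplexGaussian {E : Type*} [NormedAddCommGroup E] [NormedSpace ℝ E]
    (f : ℂ → E) :
    ∫ z, f z ∂stdComplexGaussian = ∫ z : ℂ, (Real.pi⁻¹ * Real.exp (-‖z‖ ^ 2)) • f z := by
  have hv : (1 / 2 : ℝ≥0) ≠ 0 := by norm_num
  have h1 := integral_map_equiv (μ := (gaussianReal 0 (1 / 2)).prod (gaussianReal 0 (1 / 2)))
    Complex.measurableEquivRealProd.symm f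
  have h2 : Measure.map (⇑Complex.measurableEquivRealProd.symm)
      ((gaussianReal 0 (1 / 2)).prod (gaussianReal 0 (1 / 2))) = stdComplexGaussian := rfl
  rw [h2] at h1
  rw [h1, gaussianReal_of_var_ne_zero _ hv,
    prod_withDensity (measurable_gaussianPDF _ _) (measurable_gaussianPDF _ _),
    integral_withDensity_eq_integral_toReal_smul (by fun_prop)
      (ae_of_all _ fun p => ENNReal.mul_lt_top gaussianPDF_lt_top gaussianPDF_lt_top),
    ← (Complex.volume_preserving_equiv_real_prod.symm).integral_comp
      (MeasurableEquiv.measurableEmbedding _)]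
  rw [← Measure.volume_eq_prod]
  refine integral_congr_ae (ae_of_all _ fun p => ?_)
  simp only [ENNReal.toReal_mul, toReal_gaussianPDF]
  congr 1
  have h3 : ‖Complex.measurableEquivRealProd.symm p‖ ^ 2 = p.1 ^ 2 + p.2 ^ 2 := by
    rw [← Complex.normSq_eq_norm_sq]
    change Complex.normSq ⟨p.1, p.2⟩ = _
    rw [Complex.normSq_mk]; ring
  rw [h3, gaussianPDFReal, gaussianPDFReal]
  have h4 : (2 * Real.pi * ((1 / 2 : ℝ≥0) : ℝ)) = Real.pi := by push_cast; ring
  rw [h4, mul_mul_mul_comm, ← mul_inv, Real.mul_self_sqrt Real.pi_pos.le, ← Real.exp_add]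
  congr 2
  push_cast
  ring

/-- Rotations preserve the standard complex Gaussian. -/
theorem integral_stdComplexGaussian_rotate {E : Type*} [NormedAddCommGroup E] [NormedSpace ℝ E]
    (c : Circle) (f : ℂ → E) :
    ∫ z, f (c * z) ∂stdComplexGaussian = ∫ z, f z ∂stdComplexGaussian := by
  rw [integral_stdComplexGaussian, integral_stdComplexGaussian]
  have h := (LinearIsometryEquiv.measurePreserving (rotation c)).integral_comp
    (rotation c).toHomeomorph.measurableEmbedding
    (fun z : ℂ => (Real.pi⁻¹ * Real.exp (-‖z‖ ^ 2)) • f z)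
  rw [← h]
  simp only [rotation_apply, norm_mul, Circle.norm_coe, one_mul]

theorem integral_norm_pow_stdComplexGaussian (a : ℕ) :
    ∫ z, ‖z‖ ^ (2 * a) ∂stdComplexGaussian = a.factorial := by
  rw [integral_stdComplexGaussian]
  have h := Complex.integral_rpow_mul_exp_neg_rpow (p := 2) (q := 2 * a) (by norm_num)
    (by have : (0 : ℝ) ≤ a := by positivity
        linarith)
  rw [show (2 * (a : ℝ) + 2) / 2 = a + 1 by ring, Real.Gamma_nat_eq_factorial] at h
  calc ∫ z : ℂ, (Real.pi⁻¹ * Real.exp (-‖z‖ ^ 2)) • ‖z‖ ^ (2 * a)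
      = ∫ z : ℂ, Real.pi⁻¹ * (‖z‖ ^ (2 * (a : ℝ)) * Real.exp (-‖z‖ ^ (2 : ℝ))) := by
        refine integral_congr_ae (ae_of_all _ fun z => ?_)
        have : ‖z‖ ^ (2 * (a : ℝ)) = ‖z‖ ^ (2 * a) := by
          rw [← Real.rpow_natCast]; push_cast; rfl
        simp only [this, Real.rpow_ofNat, smul_eq_mul]
        ring
    _ = _ := by
        rw [integral_const_mul, h]
        field_simp

theorem memLp_id_stdComplexGaussian (p : ℝ≥0) : MemLp id p stdComplexGaussian := by
  have h1 : MemLp (fun p : ℝ × ℝ => p.1) p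
      ((gaussianReal 0 (1 / 2)).prod (gaussianReal 0 (1 / 2))) :=
    (memLp_id_gaussianReal (μ := 0) (v := 1 / 2) p).comp_measurePreserving measurePreserving_fst
  have h2 : MemLp (fun p : ℝ × ℝ => p.2) p
      ((gaussianReal 0 (1 / 2)).prod (gaussianReal 0 (1 / 2))) :=
    (memLp_id_gaussianReal (μ := 0) (v := 1 / 2) p).comp_measurePreserving measurePreserving_snd
  have h3 : MemLp (fun p : ℝ × ℝ => (⟨p.1, p.2⟩ : ℂ)) p
      ((gaussianReal 0 (1 / 2)).prod (gaussianReal 0 (1 / 2))) := by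
    refine (h1.norm.add h2.norm).mono measurable_complexMk.aestronglyMeasurable
      (ae_of_all _ fun q => ?_)
    have h4 := Complex.norm_le_abs_re_add_abs_im ⟨q.1, q.2⟩
    refine h4.trans (le_abs_self _)
  rw [stdComplexGaussian]
  exact (memLp_map_measure_iff aestronglyMeasurable_id
    measurable_complexMk.aemeasurable).2 h3

theorem integrable_norm_pow_stdComplexGaussian (a : ℕ) :
    Integrable (fun z => ‖z‖ ^ a) stdComplexGaussian := by
  have := (memLp_id_stdComplexGaussian a).integrable_norm_pow'
  simpa using this

theorem integrable_monomial_stdComplexGaussian (a b : ℕ) :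
    Integrable (fun z : ℂ => z ^ a * (starRingEnd ℂ z) ^ b) stdComplexGaussian := by
  refine (integrable_norm_pow_stdComplexGaussian (a + b)).mono' (by fun_prop) ?_
  refine ae_of_all _ fun z => ?_
  simp [pow_add]

/-- The moments of the standard complex Gaussian. -/
theorem integral_monomial_stdComplexGaussian (a b : ℕ) :
    ∫ z, z ^ a * (starRingEnd ℂ z) ^ b ∂stdComplexGaussian
      = if a = b then (a.factorial : ℂ) else 0 := by
  split_ifs with h
  · subst h
    have h1 : ∀ z : ℂ, z ^ a * (starRingEnd ℂ z) ^ a = ((‖z‖ ^ (2 * a) : ℝ) : ℂ) := by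
      intro z
      rw [← mul_pow, Complex.mul_conj, Complex.normSq_eq_norm_sq, pow_mul]
      push_cast
      rfl
    simp_rw [h1]
    rw [integral_complex_ofReal, integral_norm_pow_stdComplexGaussian]
    simp
  · have hd : (a : ℝ) - b ≠ 0 := sub_ne_zero.2 (by exact_mod_cast h)
    -- Rotation by π/(a - b) multiplies z^a z̄^b by e^{iπ} = -1, so the integral equals its own
    -- negative.
    set c : Circle := Circle.exp (Real.pi / ((a : ℝ) - b)) with hc
    have h1 := integral_stdComplexGaussian_rotate c
      fun z : ℂ => z ^ a * (starRingEnd ℂ z) ^ b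
    have h2 : (c : ℂ) ^ a * (starRingEnd ℂ (c : ℂ)) ^ b = -1 := by
      rw [← Circle.coe_inv_eq_conj, hc, ← Circle.exp_neg, Circle.coe_exp, Circle.coe_exp,
        ← Complex.exp_nat_mul, ← Complex.exp_nat_mul, ← Complex.exp_add, ← Complex.exp_pi_mul_I]
      congr 1
      have hd' : (a : ℂ) - b ≠ 0 := by exact_mod_cast hd
      push_cast
      field_simp
      ring
    have h3 : ∀ z : ℂ, ((c : ℂ) * z) ^ a * (starRingEnd ℂ ((c : ℂ) * z)) ^ b
        = - (z ^ a * (starRingEnd ℂ z) ^ b) := by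
      intro z
      rw [map_mul, mul_pow, mul_pow, mul_mul_mul_comm, h2]
      ring
    simp_rw [h3] at h1
    rw [integral_neg] at h1
    exact CharZero.neg_eq_self_iff.1 h1

theorem charFun_stdComplexGaussian (t : ℂ) :
    charFun stdComplexGaussian t = Complex.exp (-((‖t‖ ^ 2 : ℝ) : ℂ) / 4) := by
  rw [charFun_apply, stdComplexGaussian,
    integral_map measurable_complexMk.aemeasurable (by fun_prop)]
  have h1 : ∀ p : ℝ × ℝ, Complex.exp ((inner ℝ (⟨p.1, p.2⟩ : ℂ) t : ℝ) * Complex.I)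
      = Complex.exp ((t.re * p.1 : ℂ) * Complex.I) * Complex.exp ((t.im * p.2 : ℂ) * Complex.I) := by
    intro p
    rw [← Complex.exp_add, Complex.inner]
    congr 1
    simp [Complex.mul_re]
    ring
  simp_rw [h1]
  rw [integral_prod_mul (f := fun x : ℝ => Complex.exp ((t.re * x : ℂ) * Complex.I))
    (g := fun x : ℝ => Complex.exp ((t.im * x : ℂ) * Complex.I)), ← charFun_apply_real,
    ← charFun_apply_real, charFun_gaussianReal, charFun_gaussianReal, ← Complex.exp_add,
    ← Complex.normSq_eq_norm_sq, Complex.normSq_apply]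
  congr 1
  push_cast
  ring

/-- A linear combination of independent standard complex Gaussians is a multiple of one. -/
theorem map_sum_gaussianFamily (B : Finset Freq) (c : Freq → ℂ) :
    gaussianFamily.map (fun g => ∑ n ∈ B, c n * g n)
      = stdComplexGaussian.map fun z => ((√(∑ n ∈ B, ‖c n‖ ^ 2) : ℝ) : ℂ) * z := by
  have hmul : ∀ (w t : ℂ), charFun (stdComplexGaussian.map fun z => w * z) t
      = Complex.exp (-((‖w‖ ^ 2 * ‖t‖ ^ 2 : ℝ) : ℂ) / 4) := by
    intro w t
    rw [charFun_apply, integral_map (by fun_prop) (by fun_prop)]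
    have : ∀ z : ℂ, inner ℝ (w * z) t = inner ℝ z (starRingEnd ℂ w * t) := by
      intro z
      simp only [Complex.inner, map_mul]
      congr 1
      ring
    simp_rw [this]
    rw [← charFun_apply, charFun_stdComplexGaussian, norm_mul, RCLike.norm_conj, mul_pow]
  have hind : iIndepFun (fun n (g : Freq → ℂ) => c n * g n) gaussianFamily :=
    iIndepFun_infinitePi (X := fun n (z : ℂ) => c n * z) fun n => by fun_prop
  refine Measure.ext_of_charFun ?_
  rw [iIndepFun.charFun_map_fun_finsetSum_eq_prod (fun n _ => Measurable.aemeasurable (by fun_prop))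
    (hind.restrict _)]
  ext t
  rw [hmul, Finset.prod_apply]
  have h2 : ∀ n, Measure.map (fun g : Freq → ℂ => c n * g n) gaussianFamily
      = stdComplexGaussian.map fun z => c n * z := by
    intro n
    rw [← (measurePreserving_eval_infinitePi (fun _ : Freq => stdComplexGaussian) n).map_eq,
      Measure.map_map (by fun_prop) (by fun_prop)]
    rfl
  simp_rw [h2, hmul]
  rw [← Complex.exp_sum, Complex.norm_real, Real.norm_of_nonneg (by positivity),
    Real.sq_sqrt (by positivity), ← Finset.sum_div, Finset.sum_neg_distrib, Finset.sum_mul]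
  push_cast
  rfl

/-! ### Hermite polynomials as Gaussian averages -/

/-- The Appell property turns `Polynomial.hermite_succ` into the three-term recursion that the
Gaussian averages also satisfy. -/
theorem derivative_hermite_succ (k : ℕ) :
    Polynomial.derivative (Polynomial.hermite (k + 1))
      = ((k : Polynomial ℤ) + 1) * Polynomial.hermite k := by
  induction k with
  | zero => simp
  | succ k ih =>
    rw [Polynomial.hermite_succ (k + 1), Polynomial.derivative_sub, Polynomial.derivative_mul, ih,
      Polynomial.derivative_mul, Polynomial.hermite_succ k]
    simp
    ring

theorem integrable_add_I_mul_pow (v : ℝ≥0) (x c : ℝ) (k : ℕ) :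
    Integrable (fun y : ℝ => ((x : ℂ) + Complex.I * (c * y)) ^ k) (gaussianReal 0 v) := by
  have h1 : MemLp (fun y : ℝ => (x : ℂ) + Complex.I * (c * y)) k (gaussianReal 0 v) := by
    have h2 : MemLp (fun y : ℝ => (y : ℂ)) k (gaussianReal 0 v) :=
      (memLp_id_gaussianReal' (μ := 0) (v := v) k (by simp)).ofReal
    exact (memLp_const (x : ℂ)).add ((h2.const_mul (c : ℂ)).const_mul Complex.I)
  refine (h1.integrable_norm_pow').mono' (by fun_prop) (ae_of_all _ fun y => ?_)
  rw [norm_pow]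

theorem hasDerivAt_gaussianPDFReal_one (y : ℝ) :
    HasDerivAt (gaussianPDFReal 0 1) (-y * gaussianPDFReal 0 1 y) y := by
  have h : gaussianPDFReal 0 1
      = fun y : ℝ => (√(2 * Real.pi * (1 : ℝ≥0)))⁻¹ * Real.exp (-(y - 0) ^ 2 / (2 * (1 : ℝ≥0))) := by
    funext y
    rw [gaussianPDFReal]
  rw [h]
  have h1 : HasDerivAt (fun y : ℝ => -(y - 0) ^ 2 / (2 * ((1 : ℝ≥0) : ℝ))) (-y) y := by
    have := ((((hasDerivAt_id y).sub_const 0).pow 2).neg).div_const (2 * ((1 : ℝ≥0) : ℝ))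
    convert! this using 1
    simp
    ring
  convert! (h1.exp.const_mul _) using 1
  ring

theorem integrable_smul_gaussianPDFReal {f : ℝ → ℂ} (h : Integrable f (gaussianReal 0 1)) :
    Integrable fun y => gaussianPDFReal 0 1 y • f y := by
  rw [gaussianReal_of_var_ne_zero _ one_ne_zero, integrable_withDensity_iff_integrable_smul'
    (by fun_prop) (ae_of_all _ fun _ => gaussianPDF_lt_top)] at h
  simpa only [toReal_gaussianPDF] using h

/-- Gaussian integration by parts. -/
theorem integral_mul_add_I_mul_pow_gaussianReal (x : ℝ) (k : ℕ) :
    ∫ y : ℝ, (y : ℂ) * ((x : ℂ) + Complex.I * y) ^ (k + 1) ∂(gaussianReal 0 1)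
      = Complex.I * (k + 1) * ∫ y : ℝ, ((x : ℂ) + Complex.I * y) ^ k ∂(gaussianReal 0 1) := by
  have hi : ∀ j, Integrable (fun y : ℝ => ((x : ℂ) + Complex.I * y) ^ j) (gaussianReal 0 1) :=
    fun j => by simpa using integrable_add_I_mul_pow 1 x 1 j
  have hi2 : Integrable (fun y : ℝ => (y : ℂ) * ((x : ℂ) + Complex.I * y) ^ (k + 1))
      (gaussianReal 0 1) := by
    have h1 := ((hi (k + 2)).sub ((hi (k + 1)).const_mul (x : ℂ))).const_mul (-Complex.I)
    refine h1.congr (ae_of_all _ fun y => ?_)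
    simp only [Pi.sub_apply]
    linear_combination (- ((x : ℂ) + Complex.I * y) ^ (k + 1) * y) * Complex.I_sq
  have hd : ∀ y : ℝ, HasDerivAt
      (fun y : ℝ => gaussianPDFReal 0 1 y • ((x : ℂ) + Complex.I * y) ^ (k + 1))
      (gaussianPDFReal 0 1 y • (Complex.I * (k + 1) * ((x : ℂ) + Complex.I * y) ^ k
        - (y : ℂ) * ((x : ℂ) + Complex.I * y) ^ (k + 1))) y := by
    intro y
    have h1 : HasDerivAt (fun y : ℝ => (x : ℂ) + Complex.I * y) Complex.I y := by
      have := ((Complex.ofRealCLM.hasDerivAt (x := y)).const_mul Complex.I).const_add (x : ℂ)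
      simpa using this
    have h2 := (hasDerivAt_gaussianPDFReal_one y).smul (h1.pow (k + 1))
    convert! h2 using 1
    simp only [Nat.add_sub_cancel, Complex.real_smul, Pi.pow_apply]
    push_cast
    ring
  have h0 := integral_eq_zero_of_hasDerivAt_of_integrable hd
    (integrable_smul_gaussianPDFReal (((hi k).const_mul _).sub hi2))
    (integrable_smul_gaussianPDFReal (hi (k + 1)))
  rw [← integral_gaussianReal_eq_integral_smul one_ne_zero,
    integral_sub ((hi k).const_mul _) hi2, integral_const_mul] at h0
  exact (sub_eq_zero.1 h0).symm

/-- Splitting one factor x + iy off the power and integrating the iy part by parts gives the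
recursion H_{k+2} = x H_{k+1} - (k+1) H_k for the averages. -/
theorem aeval_hermite_eq_integral (k : ℕ) : ∀ x : ℝ,
    ((Polynomial.aeval x (Polynomial.hermite k) : ℝ) : ℂ)
      = ∫ y : ℝ, ((x : ℂ) + Complex.I * y) ^ k ∂(gaussianReal 0 1) := by
  have hi : ∀ (x : ℝ) j,
      Integrable (fun y : ℝ => ((x : ℂ) + Complex.I * y) ^ j) (gaussianReal 0 1) :=
    fun x j => by simpa using integrable_add_I_mul_pow 1 x 1 j
  have hy : Integrable (fun y : ℝ => (y : ℂ)) (gaussianReal 0 1) := by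
    have := ((hi 0 1).const_mul (-Complex.I))
    refine this.congr (ae_of_all _ fun y => ?_)
    simp [← mul_assoc]
  induction k using Nat.strong_induction_on with
  | _ k ih =>
    intro x
    match k with
    | 0 => simp
    | 1 =>
      simp only [Polynomial.hermite_one, Polynomial.aeval_X, pow_one]
      rw [integral_add (integrable_const _) (hy.const_mul _), integral_const_mul,
        integral_complex_ofReal (f := fun y : ℝ => y), integral_id_gaussianReal]
      simp
    | k + 2 =>
      rw [Polynomial.hermite_succ, derivative_hermite_succ]
      simp only [map_sub, map_mul, Polynomial.aeval_X, map_add, map_natCast, map_one]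
      push_cast
      rw [ih (k + 1) (by omega), ih k (by omega)]
      have h1 := integral_mul_add_I_mul_pow_gaussianReal x k
      have h2 : ∀ y : ℝ, ((x : ℂ) + Complex.I * y) ^ (k + 2)
          = x * ((x : ℂ) + Complex.I * y) ^ (k + 1)
            + Complex.I * (y * ((x : ℂ) + Complex.I * y) ^ (k + 1)) := fun y => by ring
      have hi2 : Integrable (fun y : ℝ => (y : ℂ) * ((x : ℂ) + Complex.I * y) ^ (k + 1))
          (gaussianReal 0 1) := by
        have h1 := ((hi x (k + 2)).sub ((hi x (k + 1)).const_mul (x : ℂ))).const_mul (-Complex.I)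
        refine h1.congr (ae_of_all _ fun y => ?_)
        simp only [Pi.sub_apply]
        linear_combination (- ((x : ℂ) + Complex.I * y) ^ (k + 1) * y) * Complex.I_sq
      simp_rw [h2]
      rw [integral_add ((hi x _).const_mul _) (hi2.const_mul _), integral_const_mul,
        integral_const_mul, h1]
      linear_combination (-((k : ℂ) + 1) * ∫ y : ℝ, ((x : ℂ) + Complex.I * y) ^ k
        ∂(gaussianReal 0 1)) * Complex.I_sq

/-- The law N(0, 1/2) scaled by √v is that of the real or imaginary part of √v z with z standard
complex, so one complex Gaussian serves both Hermite factors. -/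
theorem hermiteVar_eq_integral (k : ℕ) {v : ℝ} (hv : 0 < v) (x : ℝ) :
    ((hermiteVar k (v / 2) x : ℝ) : ℂ)
      = ∫ y : ℝ, ((x : ℂ) + Complex.I * (√v * y)) ^ k ∂(gaussianReal 0 (1 / 2)) := by
  have hlaw : gaussianReal 0 (1 / 2) = (gaussianReal 0 1).map fun y => √(1 / 2) * y := by
    rw [gaussianReal_map_const_mul]
    congr 1
    · simp
    · ext
      simp
  have hs : √(v / 2) ≠ 0 := (Real.sqrt_pos.2 (by positivity)).ne'
  rw [hlaw, integral_map (by fun_prop) (by fun_prop), hermiteVar]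
  push_cast
  rw [aeval_hermite_eq_integral, ← integral_const_mul]
  refine integral_congr_ae (ae_of_all _ fun y => ?_)
  have h1 : √v * √(1 / 2) = √(v / 2) := by
    rw [← Real.sqrt_mul hv.le]
    ring_nf
  have hs' : ((√(v / 2) : ℝ) : ℂ) ≠ 0 := by exact_mod_cast hs
  simp only
  rw [← mul_pow]
  congr 1
  have h1' : (√v : ℂ) * (√(1 / 2) : ℝ) = (√(v / 2) : ℝ) := by exact_mod_cast h1
  rw [mul_add, Complex.ofReal_div, mul_div_cancel₀ _ hs', ← h1']
  ring

/-- The Wick ordering of `|w|^{2m}` for a complex Gaussian whose real and imaginary parts have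
variance `v`. -/
def wickPoly (m : ℕ) (v : ℝ) (w : ℂ) : ℝ :=
  ∑ l ∈ Finset.range (m + 1), (m.choose l : ℝ) *
    (hermiteVar (2 * l) v w.re * hermiteVar (2 * (m - l)) v w.im)

/-- With w' = √v z the integrand is ((Re w + i Re w')² + (Im w + i Im w')²)^m; the binomial theorem
and independence then split it into Hermite averages. The second factor w̄ + i w̄' is not the
conjugate of the first. -/
theorem wickPoly_eq_integral (m : ℕ) {v : ℝ} (hv : 0 < v) (w : ℂ) :
    ((wickPoly m (v / 2) w : ℝ) : ℂ) = ∫ z, ((w + Complex.I * (√v * z)) *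
      (starRingEnd ℂ w + Complex.I * starRingEnd ℂ (√v * z))) ^ m ∂stdComplexGaussian := by
  rw [stdComplexGaussian, integral_map measurable_complexMk.aemeasurable (by fun_prop), wickPoly]
  have h1 : ∀ p : ℝ × ℝ, ((w + Complex.I * (√v * (⟨p.1, p.2⟩ : ℂ))) *
      (starRingEnd ℂ w + Complex.I * starRingEnd ℂ (√v * (⟨p.1, p.2⟩ : ℂ)))) ^ m
      = ∑ l ∈ Finset.range (m + 1), (m.choose l : ℂ) *
        (((w.re : ℂ) + Complex.I * (√v * p.1)) ^ (2 * l)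
          * ((w.im : ℂ) + Complex.I * (√v * p.2)) ^ (2 * (m - l))) := by
    intro p
    have h2 : (w + Complex.I * (√v * (⟨p.1, p.2⟩ : ℂ))) *
      (starRingEnd ℂ w + Complex.I * starRingEnd ℂ (√v * (⟨p.1, p.2⟩ : ℂ)))
      = ((w.re : ℂ) + Complex.I * (√v * p.1)) ^ 2 + ((w.im : ℂ) + Complex.I * (√v * p.2)) ^ 2 := by
      have hw : w = w.re + w.im * Complex.I := (Complex.re_add_im w).symm
      have hw' : starRingEnd ℂ w = w.re - w.im * Complex.I := by
        exact Complex.ext (by simp) (by simp)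
      have hp : starRingEnd ℂ (⟨p.1, p.2⟩ : ℂ) = p.1 - p.2 * Complex.I := by
        exact Complex.ext (by simp) (by simp)
      rw [hw', map_mul, Complex.conj_ofReal, hp, Complex.mk_eq_add_mul_I]
      nth_rewrite 1 [hw]
      ring_nf
      simp only [Complex.I_sq, Complex.I_pow_three, Complex.I_pow_four]
      ring
    rw [h2, add_pow]
    refine Finset.sum_congr rfl fun l _ => ?_
    rw [pow_mul, pow_mul]
    ring
  simp_rw [h1]
  rw [integral_finsetSum]
  · push_cast
    refine Finset.sum_congr rfl fun l _ => ?_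
    rw [integral_const_mul, integral_prod_mul
      (f := fun y : ℝ => ((w.re : ℂ) + Complex.I * (√v * y)) ^ (2 * l))
      (g := fun y : ℝ => ((w.im : ℂ) + Complex.I * (√v * y)) ^ (2 * (m - l))),
      hermiteVar_eq_integral _ hv, hermiteVar_eq_integral _ hv]
  · intro l _
    exact ((integrable_add_I_mul_pow _ _ _ _).mul_prod
      (integrable_add_I_mul_pow _ _ _ _)).const_mul _

/-! ### Moment bounds for holomorphic polynomials of independent complex Gaussians -/

/-- The family `ζ` has the joint moments of independent standard complex Gaussians. -/
def HasGaussianMoments {Ω J : Type*} [MeasurableSpace Ω] [Fintype J] [DecidableEq J]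
    (P : Measure Ω) (ζ : J → Ω → ℂ) : Prop :=
  ∀ a b : J → ℕ,
    Integrable (fun ω => ∏ j, (ζ j ω ^ a j * starRingEnd ℂ (ζ j ω) ^ b j)) P ∧
      ∫ ω, ∏ j, (ζ j ω ^ a j * starRingEnd ℂ (ζ j ω) ^ b j) ∂P
        = if a = b then ((∏ j, (a j).factorial : ℕ) : ℂ) else 0

theorem pow_card_sum {J κ R : Type*} [CommSemiring R] [Fintype J] [Fintype κ]
    [DecidableEq κ] (f : J → R) :
    (∑ j, f j) ^ Fintype.card κ = ∑ ν : κ → J, ∏ i, f (ν i) := by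
  have := Finset.prod_univ_sum (fun _ : κ => (Finset.univ : Finset J)) fun _ j => f j
  rw [Finset.prod_const, Fintype.piFinset_univ] at this
  exact this

/-- The number of times each index occurs in a tuple. -/
def occ {J κ : Type*} [DecidableEq J] [Fintype κ] (ν : κ → J) (j : J) : ℕ := (Finset.univ.filter fun i => ν i = j).card

theorem prod_comp_eq_prod_pow_occ {J κ M : Type*} [Fintype J] [DecidableEq J] [Fintype κ]
    [CommMonoid M] (ν : κ → J) (f : J → M) :
    ∏ i, f (ν i) = ∏ j, f j ^ occ ν j := by
  rw [← Finset.prod_fiberwise Finset.univ ν]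
  refine Finset.prod_congr rfl fun j _ => ?_
  rw [occ, ← Finset.prod_const]
  refine Finset.prod_congr rfl fun i hi => ?_
  rw [(Finset.mem_filter.1 hi).2]

theorem sum_occ {J κ : Type*} [Fintype J] [DecidableEq J] [Fintype κ] (ν : κ → J) : ∑ j, occ ν j = Fintype.card κ := by
  unfold occ
  rw [← Finset.card_eq_sum_card_fiberwise (fun _ _ => Finset.mem_univ _)]
  rfl

theorem monomial_mul_conj_monomial {Ω J κ : Type*} [Fintype J] [DecidableEq J] [Fintype κ]
    (ζ : J → Ω → ℂ) (ν ν' : κ → J) (ω : Ω) :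
    (∏ i, ζ (ν i) ω) * starRingEnd ℂ (∏ i, ζ (ν' i) ω)
      = ∏ j, (ζ j ω ^ occ ν j * starRingEnd ℂ (ζ j ω) ^ occ ν' j) := by
  rw [map_prod, prod_comp_eq_prod_pow_occ ν fun j => ζ j ω,
    prod_comp_eq_prod_pow_occ ν' fun j => starRingEnd ℂ (ζ j ω), Finset.prod_mul_distrib]

section Moments

variable {Ω J κ Λ : Type*} [MeasurableSpace Ω] [Fintype J] [DecidableEq J] [Fintype κ] [Fintype Λ]
  {P : Measure Ω} {ζ : J → Ω → ℂ}

/-- The covariance of the monomials indexed by two tuples. -/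
def wickPairing (ν ν' : κ → J) : ℝ :=
  if occ ν = occ ν' then ((∏ j, (occ ν j).factorial : ℕ) : ℝ) else 0

theorem wickPairing_nonneg (ν ν' : κ → J) : 0 ≤ wickPairing ν ν' := by
  unfold wickPairing
  split_ifs <;> positivity

theorem wickPairing_comm (ν ν' : κ → J) : wickPairing ν ν' = wickPairing ν' ν := by
  unfold wickPairing
  by_cases h : occ ν = occ ν'
  · simp [h]
  · rw [if_neg h, if_neg (Ne.symm h)]

theorem HasGaussianMoments.integrable_pairing (h : HasGaussianMoments P ζ) (ν ν' : κ → J) :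
    Integrable (fun ω => (∏ i, ζ (ν i) ω) * starRingEnd ℂ (∏ i, ζ (ν' i) ω)) P := by
  simp_rw [monomial_mul_conj_monomial]
  exact (h _ _).1

theorem HasGaussianMoments.integral_pairing (h : HasGaussianMoments P ζ) (ν ν' : κ → J) :
    ∫ ω, (∏ i, ζ (ν i) ω) * starRingEnd ℂ (∏ i, ζ (ν' i) ω) ∂P = (wickPairing ν ν' : ℝ) := by
  simp_rw [monomial_mul_conj_monomial]
  rw [(h _ _).2, wickPairing]
  split_ifs <;> simp

/-- The pairing of ζ^ν with (∑ ζ_j)^d is computed twice: over tuples, and by the multinomial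
theorem, where only the exponent `occ ν` survives and multinomial times factorials is d!. -/
theorem HasGaussianMoments.sum_wickPairing [DecidableEq κ] (h : HasGaussianMoments P ζ)
    (ν : κ → J) :
    ∑ ν' : κ → J, wickPairing ν ν' = (Fintype.card κ).factorial := by
  have h1 : ∫ ω, (∏ i, ζ (ν i) ω) * starRingEnd ℂ ((∑ j, ζ j ω) ^ Fintype.card κ) ∂P
      = ((∑ ν' : κ → J, wickPairing ν ν' : ℝ) : ℂ) := by
    simp_rw [pow_card_sum (κ := κ), map_sum, Finset.mul_sum]
    rw [integral_finsetSum _ fun ν' _ => h.integrable_pairing ν ν']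
    simp_rw [h.integral_pairing]
    push_cast
    rfl
  have h2 : ∫ ω, (∏ i, ζ (ν i) ω) * starRingEnd ℂ ((∑ j, ζ j ω) ^ Fintype.card κ) ∂P
      = ((Fintype.card κ).factorial : ℂ) := by
    have h3 : ∀ ω, (∏ i, ζ (ν i) ω) * starRingEnd ℂ ((∑ j, ζ j ω) ^ Fintype.card κ)
        = ∑ k ∈ Finset.piAntidiag Finset.univ (Fintype.card κ),
          (Nat.multinomial Finset.univ k : ℂ)
            * ∏ j, (ζ j ω ^ occ ν j * starRingEnd ℂ (ζ j ω) ^ k j) := by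
      intro ω
      rw [map_pow, map_sum, Finset.sum_pow_eq_sum_piAntidiag, Finset.mul_sum,
        prod_comp_eq_prod_pow_occ ν fun j => ζ j ω]
      refine Finset.sum_congr rfl fun k _ => ?_
      rw [Finset.prod_mul_distrib]
      ring
    simp_rw [h3]
    rw [integral_finsetSum _ fun k _ => ((h _ _).1.const_mul _)]
    simp_rw [integral_const_mul, (h _ _).2]
    rw [Finset.sum_eq_single (occ ν)]
    · rw [if_pos rfl]
      have := Nat.multinomial_spec Finset.univ (occ ν)
      rw [sum_occ] at this
      rw [← this]
      push_cast
      ring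
    · intro k _ hk
      rw [if_neg (Ne.symm hk), mul_zero]
    · intro hk
      exact absurd (Finset.mem_piAntidiag.2 ⟨sum_occ ν, by simp⟩) hk
  rw [h1] at h2
  exact_mod_cast h2

/-- The second moment of a homogeneous polynomial of degree `|κ|` is at most `|κ|!` times the sum
of the squares of its coefficients. -/
theorem HasGaussianMoments.lintegral_sq_le (h : HasGaussianMoments P ζ) {n : Λ → κ → J}
    (hn : Function.Injective n) (T : Λ → ℂ) :
    ∫⁻ ω, ‖∑ l, T l * ∏ i, ζ (n l i) ω‖ₑ ^ 2 ∂P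
      ≤ ENNReal.ofReal ((Fintype.card κ).factorial * ∑ l, ‖T l‖ ^ 2) := by
  classical
  have hsq : ∀ ω, ((‖∑ l, T l * ∏ i, ζ (n l i) ω‖ ^ 2 : ℝ) : ℂ)
      = ∑ l, ∑ l', T l * starRingEnd ℂ (T l')
        * ((∏ i, ζ (n l i) ω) * starRingEnd ℂ (∏ i, ζ (n l' i) ω)) := by
    intro ω
    rw [Complex.ofReal_pow, ← Complex.mul_conj', map_sum, Finset.sum_mul_sum]
    refine Finset.sum_congr rfl fun l _ => Finset.sum_congr rfl fun l' _ => ?_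
    rw [map_mul]
    ring
  have hint : Integrable (fun ω => ((‖∑ l, T l * ∏ i, ζ (n l i) ω‖ ^ 2 : ℝ) : ℂ)) P := by
    simp_rw [hsq]
    exact integrable_finsetSum _ fun l _ => integrable_finsetSum _ fun l' _ =>
      (h.integrable_pairing _ _).const_mul _
  have hint' : Integrable (fun ω => ‖∑ l, T l * ∏ i, ζ (n l i) ω‖ ^ 2) P := by
    exact hint.re
  have hval : ((∫ ω, ‖∑ l, T l * ∏ i, ζ (n l i) ω‖ ^ 2 ∂P : ℝ) : ℂ)
      = ∑ l, ∑ l', T l * starRingEnd ℂ (T l') * (wickPairing (n l) (n l') : ℝ) := by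
    rw [← integral_complex_ofReal]
    simp_rw [hsq]
    rw [integral_finsetSum _ fun l _ => integrable_finsetSum _ fun l' _ =>
      (h.integrable_pairing _ _).const_mul _]
    refine Finset.sum_congr rfl fun l _ => ?_
    rw [integral_finsetSum _ fun l' _ => (h.integrable_pairing _ _).const_mul _]
    refine Finset.sum_congr rfl fun l' _ => ?_
    rw [integral_const_mul, h.integral_pairing]
  -- The row sums of the covariance matrix are at most d!, since by injectivity they are part of the
  -- sum over all tuples. With symmetry this is the Schur test.
  have hrow : ∀ l, ∑ l', wickPairing (n l) (n l') ≤ (Fintype.card κ).factorial := by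
    intro l
    rw [← h.sum_wickPairing (n l), ← Finset.sum_image (f := fun ν' => wickPairing (n l) ν')
      (fun _ _ _ _ hab => hn hab)]
    exact Finset.sum_le_sum_of_subset_of_nonneg (Finset.subset_univ _)
      fun _ _ _ => wickPairing_nonneg _ _
  have hbound : ∫ ω, ‖∑ l, T l * ∏ i, ζ (n l i) ω‖ ^ 2 ∂P
      ≤ (Fintype.card κ).factorial * ∑ l, ‖T l‖ ^ 2 := by
    have h0 : 0 ≤ ∫ ω, ‖∑ l, T l * ∏ i, ζ (n l i) ω‖ ^ 2 ∂P :=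
      integral_nonneg fun _ => by positivity
    calc ∫ ω, ‖∑ l, T l * ∏ i, ζ (n l i) ω‖ ^ 2 ∂P
        = ‖((∫ ω, ‖∑ l, T l * ∏ i, ζ (n l i) ω‖ ^ 2 ∂P : ℝ) : ℂ)‖ := by
          rw [Complex.norm_real, Real.norm_of_nonneg h0]
      _ ≤ ∑ l, ∑ l', ‖T l‖ * ‖T l'‖ * wickPairing (n l) (n l') := by
          rw [hval]
          refine (norm_sum_le _ _).trans (Finset.sum_le_sum fun l _ =>
            (norm_sum_le _ _).trans (Finset.sum_le_sum fun l' _ => ?_))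
          rw [norm_mul, norm_mul, RCLike.norm_conj, Complex.norm_real,
            Real.norm_of_nonneg (wickPairing_nonneg _ _)]
      _ ≤ ∑ l, ∑ l', (‖T l‖ ^ 2 / 2 * wickPairing (n l) (n l')
            + ‖T l'‖ ^ 2 / 2 * wickPairing (n l') (n l)) := by
          refine Finset.sum_le_sum fun l _ => Finset.sum_le_sum fun l' _ => ?_
          rw [wickPairing_comm (n l') (n l), ← add_mul]
          refine mul_le_mul_of_nonneg_right ?_ (wickPairing_nonneg _ _)
          nlinarith [sq_nonneg (‖T l‖ - ‖T l'‖)]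
      _ = ∑ l, ‖T l‖ ^ 2 * ∑ l', wickPairing (n l) (n l') := by
          simp_rw [Finset.sum_add_distrib]
          rw [Finset.sum_comm (f := fun l l' => ‖T l'‖ ^ 2 / 2 * wickPairing (n l') (n l)),
            ← Finset.sum_add_distrib]
          refine Finset.sum_congr rfl fun l _ => ?_
          rw [← Finset.mul_sum]
          ring
      _ ≤ ∑ l, ‖T l‖ ^ 2 * (Fintype.card κ).factorial :=
          Finset.sum_le_sum fun l _ => mul_le_mul_of_nonneg_left (hrow l) (by positivity)
      _ = _ := by rw [← Finset.sum_mul, mul_comm]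
  calc ∫⁻ ω, ‖∑ l, T l * ∏ i, ζ (n l i) ω‖ₑ ^ 2 ∂P
      = ∫⁻ ω, ENNReal.ofReal (‖∑ l, T l * ∏ i, ζ (n l i) ω‖ ^ 2) ∂P := by
        refine lintegral_congr fun ω => ?_
        rw [ENNReal.ofReal_pow (norm_nonneg _), ofReal_norm]
    _ = ENNReal.ofReal (∫ ω, ‖∑ l, T l * ∏ i, ζ (n l i) ω‖ ^ 2 ∂P) :=
        (ofReal_integral_eq_lintegral_ofReal hint' (ae_of_all _ fun _ => by positivity)).symm
    _ ≤ _ := ENNReal.ofReal_le_ofReal hbound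

/-- Higher moments of a homogeneous polynomial of degree `|κ|`. -/
theorem HasGaussianMoments.lintegral_pow_le (h : HasGaussianMoments P ζ) {n : Λ → κ → J}
    (hn : Function.Injective n) (T : Λ → ℂ) (k : ℕ) :
    ∫⁻ ω, ‖∑ l, T l * ∏ i, ζ (n l i) ω‖ₑ ^ (2 * k) ∂P
      ≤ ENNReal.ofReal ((k * Fintype.card κ).factorial * (∑ l, ‖T l‖ ^ 2) ^ k) := by
  classical
  -- The k-th power is a holomorphic polynomial over concatenated tuples, of degree k|κ|, so its
  -- second moment is the 2k-th moment sought.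
  let n' : (Fin k → Λ) → (Fin k × κ → J) := fun l q => n (l q.1) q.2
  have hn' : Function.Injective n' := fun l l' hl => funext fun q =>
    hn (funext fun i => congrFun hl (q, i))
  have h1 := h.lintegral_sq_le hn' fun l => ∏ q, T (l q)
  have h2 : ∀ ω, ‖∑ l : Fin k → Λ, (∏ q, T (l q)) * ∏ i, ζ (n' l i) ω‖ₑ ^ 2
      = ‖∑ l, T l * ∏ i, ζ (n l i) ω‖ₑ ^ (2 * k) := by
    intro ω
    have h3 := pow_card_sum (κ := Fin k) fun l => T l * ∏ i, ζ (n l i) ω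
    rw [Fintype.card_fin] at h3
    have h5 : ∀ l : Fin k → Λ, ∏ q, (T (l q) * ∏ i, ζ (n (l q) i) ω)
        = (∏ q, T (l q)) * ∏ i, ζ (n' l i) ω := by
      intro l
      rw [Finset.prod_mul_distrib, Fintype.prod_prod_type]
    simp_rw [h5] at h3
    rw [mul_comm 2 k, pow_mul, ← enorm_pow _ k, h3]
  simp_rw [h2] at h1
  refine h1.trans (le_of_eq ?_)
  have h4 := pow_card_sum (κ := Fin k) fun l => ‖T l‖ ^ 2
  rw [Fintype.card_fin] at h4
  rw [h4, Fintype.card_prod, Fintype.card_fin]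
  simp_rw [norm_prod, Finset.prod_pow]

end Moments

/-! ### Complexification of the real and imaginary parts of the Gaussian family -/

theorem measurePreserving_prod_comm_inner {α β γ δ : Type*} [MeasurableSpace α] [MeasurableSpace β]
    [MeasurableSpace γ] [MeasurableSpace δ] (a : Measure α) (b : Measure β) (c : Measure γ)
    (d : Measure δ) [SFinite a] [SFinite b] [SFinite c] [SFinite d] :
    MeasurePreserving (fun q : (α × β) × (γ × δ) => ((q.1.1, q.2.1), (q.1.2, q.2.2)))
      ((a.prod b).prod (c.prod d)) ((a.prod c).prod (b.prod d)) := by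
  have h1 := measurePreserving_prodAssoc a b (c.prod d)
  have h2 := (MeasurePreserving.id a).prod (measurePreserving_prodAssoc b c d).symm
  have h3 := (MeasurePreserving.id a).prod ((Measure.measurePreserving_swap (μ := b) (ν := c)).prod
    (MeasurePreserving.id d))
  have h4 := (MeasurePreserving.id a).prod (measurePreserving_prodAssoc c b d)
  have h5 := (measurePreserving_prodAssoc a c (b.prod d)).symm
  exact h5.comp (h4.comp (h3.comp (h2.comp h1)))

theorem measurePreserving_complexMk : MeasurePreserving (fun p : ℝ × ℝ => (⟨p.1, p.2⟩ : ℂ))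
    ((gaussianReal 0 (1 / 2)).prod (gaussianReal 0 (1 / 2))) stdComplexGaussian :=
  ⟨measurable_complexMk, rfl⟩

theorem measurable_reim :
    Measurable fun q : ℂ × ℂ => ((⟨q.1.re, q.2.re⟩ : ℂ), (⟨q.1.im, q.2.im⟩ : ℂ)) :=
  (measurable_complexMk.comp (f := fun q : ℂ × ℂ => (q.1.re, q.2.re)) (by fun_prop)).prodMk
    (measurable_complexMk.comp (f := fun q : ℂ × ℂ => (q.1.im, q.2.im)) (by fun_prop))

/-- Both sides consist of four independent N(0, 1/2) variables; only the grouping into complex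
numbers changes. -/
theorem measurePreserving_reim :
    MeasurePreserving (fun q : ℂ × ℂ => ((⟨q.1.re, q.2.re⟩ : ℂ), (⟨q.1.im, q.2.im⟩ : ℂ)))
      (stdComplexGaussian.prod stdComplexGaussian)
      (stdComplexGaussian.prod stdComplexGaussian) := by
  refine ⟨measurable_reim, ?_⟩
  have h1 := measurePreserving_complexMk.prod measurePreserving_complexMk
  have h2 := h1.comp (measurePreserving_prod_comm_inner (gaussianReal 0 (1 / 2))
    (gaussianReal 0 (1 / 2)) (gaussianReal 0 (1 / 2)) (gaussianReal 0 (1 / 2)))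
  conv_lhs => rw [← h1.map_eq]
  rw [Measure.map_map measurable_reim h1.measurable]
  exact h2.map_eq

/-- The complexified real (`true`) and imaginary (`false`) parts of the modes. -/
def zeta (j : Freq × Bool) (ω : (Freq → ℂ) × (Freq → ℂ)) : ℂ :=
  if j.2 then ⟨(ω.1 j.1).re, (ω.2 j.1).re⟩ else ⟨(ω.1 j.1).im, (ω.2 j.1).im⟩

/-- This identity and the next express g + i g' and ḡ + i ḡ' through ζ alone, which makes the
complexified energy holomorphic in ζ. -/
theorem zeta_add_I_mul (n : Freq) (ω : (Freq → ℂ) × (Freq → ℂ)) :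
    zeta (n, true) ω + Complex.I * zeta (n, false) ω = ω.1 n + Complex.I * ω.2 n := by
  apply Complex.ext
  · simp [zeta]
  · simp [zeta]
    ring

theorem zeta_sub_I_mul (n : Freq) (ω : (Freq → ℂ) × (Freq → ℂ)) :
    zeta (n, true) ω - Complex.I * zeta (n, false) ω
      = starRingEnd ℂ (ω.1 n) + Complex.I * starRingEnd ℂ (ω.2 n) := by
  apply Complex.ext
  · simp [zeta]
  · simp [zeta]
    ring

theorem measurePreserving_modes (B : Finset Freq) :
    MeasurePreserving (fun (ω : (Freq → ℂ) × (Freq → ℂ)) (n : B) => (ω.1 n, ω.2 n))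
      (gaussianFamily.prod gaussianFamily)
      (Measure.pi fun _ : B => stdComplexGaussian.prod stdComplexGaussian) := by
  have h1 : MeasurePreserving (B.restrict (π := fun _ => ℂ)) gaussianFamily
      (Measure.pi fun _ : B => stdComplexGaussian) :=
    ⟨Finset.measurable_restrict _, Measure.infinitePi_map_restrict _⟩
  have h2 := (measurePreserving_arrowProdEquivProdArrow ℂ ℂ B
    (fun _ => stdComplexGaussian) (fun _ => stdComplexGaussian)).symm
  exact h2.comp (h1.prod h1)

theorem measurable_zeta (j : Freq × Bool) : Measurable (zeta j) := by
  unfold zeta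
  rcases j with ⟨n, c⟩
  cases c
  · exact measurable_complexMk.comp
      (f := fun ω : (Freq → ℂ) × (Freq → ℂ) => ((ω.1 n).im, (ω.2 n).im)) (by fun_prop)
  · exact measurable_complexMk.comp
      (f := fun ω : (Freq → ℂ) × (Freq → ℂ) => ((ω.1 n).re, (ω.2 n).re)) (by fun_prop)

/-- Different modes are independent, and within a mode `measurePreserving_reim` splits the moment
into two one-variable moments. -/
theorem hasGaussianMoments_zeta (B : Finset Freq) :
    HasGaussianMoments (gaussianFamily.prod gaussianFamily)
      (fun (j : B × Bool) => zeta (j.1, j.2)) := by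
  intro a b
  let ψ : B × Bool → ℂ → ℂ := fun j z => z ^ a j * starRingEnd ℂ z ^ b j
  let φ : B → ℂ × ℂ → ℂ := fun n q => ψ (n, true) q.1 * ψ (n, false) q.2
  let r : ℂ × ℂ → ℂ × ℂ := fun q => ((⟨q.1.re, q.2.re⟩ : ℂ), (⟨q.1.im, q.2.im⟩ : ℂ))
  have hψ : ∀ j, Measurable (ψ j) := fun j => by fun_prop
  have hφ : ∀ n, Measurable (φ n) := fun n =>
    ((hψ _).comp measurable_fst).mul ((hψ _).comp measurable_snd)
  have h0 : (fun ω => ∏ j : B × Bool, (zeta (j.1, j.2) ω ^ a j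
        * starRingEnd ℂ (zeta (j.1, j.2) ω) ^ b j))
      = (fun x : B → ℂ × ℂ => ∏ n, φ n (r (x n))) ∘ fun ω (n : B) => (ω.1 n, ω.2 n) := by
    funext ω
    rw [Fintype.prod_prod_type]
    refine Finset.prod_congr rfl fun n _ => ?_
    rw [Fintype.prod_bool]
    rfl
  have hm : Measurable (fun x : B → ℂ × ℂ => ∏ n, φ n (r (x n))) :=
    Finset.measurable_fun_prod _ fun n _ =>
      (hφ n).comp (measurable_reim.comp (measurable_pi_apply n))
  have hφi : ∀ n, Integrable (φ n) (stdComplexGaussian.prod stdComplexGaussian) := fun n =>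
    (integrable_monomial_stdComplexGaussian _ _).mul_prod
      (integrable_monomial_stdComplexGaussian _ _)
  have hφr : ∀ n, Integrable (fun q => φ n (r q)) (stdComplexGaussian.prod stdComplexGaussian) :=
    fun n => measurePreserving_reim.integrable_comp_of_integrable (hφi n)
  rw [h0]
  refine ⟨(measurePreserving_modes B).integrable_comp_of_integrable (Integrable.fintype_prod hφr), ?_⟩
  have h1 := integral_map (measurePreserving_modes B).measurable.aemeasurable
    (hm.aestronglyMeasurable (μ := (gaussianFamily.prod gaussianFamily).map
      fun ω (n : B) => (ω.1 n, ω.2 n)))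
  rw [(measurePreserving_modes B).map_eq] at h1
  simp only [Function.comp_def]
  rw [← h1, integral_fintype_prod_eq_prod (f := fun n q => φ n (r q))]
  have h2 : ∀ n, ∫ q, φ n (r q) ∂(stdComplexGaussian.prod stdComplexGaussian)
      = ∏ c : Bool, if a (n, c) = b (n, c) then ((a (n, c)).factorial : ℂ) else 0 := by
    intro n
    have h3 := integral_map measurePreserving_reim.measurable.aemeasurable
      ((hφ n).aestronglyMeasurable (μ := (stdComplexGaussian.prod stdComplexGaussian).map r))
    rw [measurePreserving_reim.map_eq] at h3
    rw [← h3, integral_prod_mul, integral_monomial_stdComplexGaussian,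
      integral_monomial_stdComplexGaussian, Fintype.prod_bool]
  simp_rw [h2]
  rw [← Fintype.prod_prod_type (fun j => if a j = b j then ((a j).factorial : ℂ) else 0)]
  split_ifs with h
  · subst h
    simp
  · obtain ⟨j, hj⟩ := Function.ne_iff.1 h
    exact Finset.prod_eq_zero (Finset.mem_univ j) (if_neg hj)

/-! ### Characters -/

theorem expChar_add (n n' : Freq) (x : Torus) :
    expChar (n + n') x = expChar n x * expChar n' x := by
  simp only [expChar, Prod.fst_add, Prod.snd_add, fourier_add]
  ring

theorem expChar_neg (n : Freq) (x : Torus) : expChar (-n) x = starRingEnd ℂ (expChar n x) := by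
  simp only [expChar, Prod.fst_neg, Prod.snd_neg, fourier_neg, map_mul]

theorem expChar_zero (x : Torus) : expChar 0 x = 1 := by
  simp [expChar]

theorem expChar_sum {ι : Type*} (s : Finset ι) (f : ι → Freq) (x : Torus) :
    expChar (∑ i ∈ s, f i) x = ∏ i ∈ s, expChar (f i) x := by
  classical
  induction s using Finset.induction_on with
  | empty => simp [expChar_zero]
  | insert a s ha ih => rw [Finset.sum_insert ha, Finset.prod_insert ha, expChar_add, ih]

theorem norm_expChar (n : Freq) (x : Torus) : ‖expChar n x‖ = 1 := by
  rw [expChar, norm_mul, fourier_apply, fourier_apply, Circle.norm_coe, Circle.norm_coe, one_mul]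

theorem continuous_expChar (n : Freq) : Continuous (expChar n) :=
  ((fourier n.1).continuous.comp continuous_fst).mul ((fourier n.2).continuous.comp continuous_snd)

theorem integral_fourier_eq_zero {k : ℤ} (hk : k ≠ 0) :
    ∫ x : AddCircle (2 * Real.pi), fourier k x = 0 :=
  integral_eq_zero_of_add_right_eq_neg (fourier_add_half_inv_index hk Real.two_pi_pos)

theorem integral_expChar_eq_zero {n : Freq} (hn : n ≠ 0) : ∫ x : Torus, expChar n x = 0 := by
  unfold expChar
  rw [Measure.volume_eq_prod, integral_prod_mul (f := fun x => fourier n.1 x)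
    (g := fun x => fourier n.2 x)]
  by_cases h : n.1 = 0
  · have h2 : n.2 ≠ 0 := fun h2 => hn (Prod.ext h h2)
    rw [integral_fourier_eq_zero h2, mul_zero]
  · rw [integral_fourier_eq_zero h, zero_mul]

/-! ### The renormalized energy as a Gaussian chaos -/

/-- The truncated Fourier series of the free field with modes `g`. -/
def field (N : ℕ) (g : Freq → ℂ) (x : Torus) : ℂ :=
  ∑ n ∈ freqBall N, expChar n x / bracket n * g n

/-- The renormalized energy as a function of the modes. -/
def energy (m N : ℕ) (g : Freq → ℂ) : ℝ :=
  1 / (2 * (m : ℝ)) * ∫ x : Torus, wickPoly m (sigma N / 2) (field N g x)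

theorem bracket_sq (n : Freq) : bracket n ^ 2 = 1 + (n.1 : ℝ) ^ 2 + (n.2 : ℝ) ^ 2 :=
  Real.sq_sqrt (by positivity)

theorem sigma_eq (N : ℕ) : sigma N = ∑ n ∈ freqBall N, (bracket n ^ 2)⁻¹ := by
  simp [sigma, bracket_sq]

theorem zero_mem_freqBall (N : ℕ) : (0 : Freq) ∈ freqBall N := by
  simp [mem_freqBall]

theorem sigma_pos (N : ℕ) : 0 < sigma N :=
  Finset.sum_pos (fun n _ => by positivity) ⟨0, zero_mem_freqBall N⟩

theorem map_field (N : ℕ) (x : Torus) :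
    gaussianFamily.map (fun g => field N g x)
      = stdComplexGaussian.map fun z => ((√(sigma N) : ℝ) : ℂ) * z := by
  have h : ∑ n ∈ freqBall N, ‖expChar n x / bracket n‖ ^ 2 = sigma N := by
    rw [sigma_eq]
    refine Finset.sum_congr rfl fun n _ => ?_
    rw [norm_div, norm_expChar, Complex.norm_real, Real.norm_of_nonneg (bracket_pos n).le, div_pow,
      one_pow, one_div]
  unfold field
  rw [map_sum_gaussianFamily, h]

theorem measurable_field (N : ℕ) (x : Torus) : Measurable fun g => field N g x := by
  unfold field
  fun_prop

/-- The auxiliary Gaussian √σ_N z has the same law at every x as the field of an independent copy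
g', so a single family g' serves all points of the torus. -/
theorem wickPoly_field_eq_integral (m N : ℕ) (g : Freq → ℂ) (x : Torus) :
    ((wickPoly m (sigma N / 2) (field N g x) : ℝ) : ℂ)
      = ∫ g', ((field N g x + Complex.I * field N g' x) * (starRingEnd ℂ (field N g x)
        + Complex.I * starRingEnd ℂ (field N g' x))) ^ m ∂gaussianFamily := by
  rw [wickPoly_eq_integral m (sigma_pos N)]
  have h1 := integral_map (μ := gaussianFamily) (measurable_field N x).aemeasurable
    (f := fun w : ℂ => ((field N g x + Complex.I * w) * (starRingEnd ℂ (field N g x)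
        + Complex.I * starRingEnd ℂ w)) ^ m) (by fun_prop)
  have h2 := integral_map (μ := stdComplexGaussian) (φ := fun z => ((√(sigma N) : ℝ) : ℂ) * z)
    (by fun_prop)
    (f := fun w : ℂ => ((field N g x + Complex.I * w) * (starRingEnd ℂ (field N g x)
        + Complex.I * starRingEnd ℂ w)) ^ m) (by fun_prop)
  rw [← h1, ← h2, map_field]

/-- The positive (`true`) and negative (`false`) characters. -/
def signChar (b : Bool) (n : Freq) : Freq := if b then n else -n

/-- The coefficients of the real and imaginary parts in `w` (`true`) and its conjugate
(`false`). -/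
def phase (b c : Bool) : ℂ := if c then 1 else if b then Complex.I else -Complex.I

theorem norm_phase (b c : Bool) : ‖phase b c‖ = 1 := by
  cases b <;> cases c <;> simp [phase]

/-- The Fourier multiplier of the truncated field. -/
def weight (N : ℕ) (n : Freq) : ℝ := if n ∈ freqBall N then (bracket n)⁻¹ else 0

theorem weight_nonneg (N : ℕ) (n : Freq) : 0 ≤ weight N n := by
  unfold weight
  have := bracket_pos n
  split_ifs <;> positivity

theorem weight_le (N : ℕ) (n : Freq) : weight N n ≤ (bracket n)⁻¹ := by
  unfold weight
  have := bracket_pos n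
  split_ifs
  · exact le_rfl
  · positivity

theorem freqBall_mono {M N : ℕ} (h : M ≤ N) : freqBall M ⊆ freqBall N := by
  intro n hn
  rw [mem_freqBall] at hn ⊢
  exact hn.trans (by exact_mod_cast h)

/-- Puts both cutoffs on the index set of the larger one, so that energies can be subtracted
coefficient by coefficient. -/
theorem field_eq_sum_weight {M N : ℕ} (h : M ≤ N) (g : Freq → ℂ) (x : Torus) :
    field M g x = ∑ n ∈ freqBall N, (weight M n * expChar n x) * g n := by
  rw [field, ← Finset.sum_subset (freqBall_mono h)]
  · refine Finset.sum_congr rfl fun n hn => ?_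
    rw [weight, if_pos hn]
    push_cast
    ring
  · intro n _ hn
    simp [weight, hn]

/-- The coefficient of a monomial in the energy density, at a point of the torus. -/
def chaosCoeff (m M N : ℕ) (l : Fin m × Bool → freqBall N × Bool) (x : Torus) : ℂ :=
  ∏ i, (weight M (l i).1 * phase i.2 (l i).2 * expChar (signChar i.2 (l i).1) x)

theorem field_factor {M N : ℕ} (h : M ≤ N) (ω : (Freq → ℂ) × (Freq → ℂ)) (x : Torus) (b : Bool) :
    ∑ j : freqBall N × Bool,
        (weight M j.1 * phase b j.2 * expChar (signChar b j.1) x) * zeta (j.1, j.2) ω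
      = if b then field M ω.1 x + Complex.I * field M ω.2 x
        else starRingEnd ℂ (field M ω.1 x) + Complex.I * starRingEnd ℂ (field M ω.2 x) := by
  rw [Fintype.sum_prod_type]
  simp only [field_eq_sum_weight h]
  cases b
  · simp only [Bool.false_eq_true, ↓reduceIte, map_sum, Finset.mul_sum,
      ← Finset.sum_add_distrib, map_mul, Complex.conj_ofReal]
    rw [← Finset.sum_coe_sort (freqBall N)]
    refine Finset.sum_congr rfl fun n _ => ?_
    have h1 := zeta_sub_I_mul (n : Freq) ω
    rw [Fintype.sum_bool]
    simp only [phase, signChar, Bool.false_eq_true, ↓reduceIte, expChar_neg]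
    linear_combination (weight M n * starRingEnd ℂ (expChar n x)) * h1
  · simp only [↓reduceIte, Finset.mul_sum, ← Finset.sum_add_distrib]
    rw [← Finset.sum_coe_sort (freqBall N)]
    refine Finset.sum_congr rfl fun n _ => ?_
    have h1 := zeta_add_I_mul (n : Freq) ω
    rw [Fintype.sum_bool]
    simp only [phase, signChar, Bool.false_eq_true, ↓reduceIte]
    linear_combination (weight M n * expChar n x) * h1

/-- In `Fin m × Bool` the Boolean tells the unconjugated factor from the conjugated one; in
`freqBall N × Bool` it tells real part from imaginary part. -/
theorem chaos_expansion (m : ℕ) {M N : ℕ} (h : M ≤ N) (ω : (Freq → ℂ) × (Freq → ℂ)) (x : Torus) :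
    ((field M ω.1 x + Complex.I * field M ω.2 x) * (starRingEnd ℂ (field M ω.1 x)
        + Complex.I * starRingEnd ℂ (field M ω.2 x))) ^ m
      = ∑ l : Fin m × Bool → freqBall N × Bool,
        chaosCoeff m M N l x * ∏ i, zeta ((l i).1, (l i).2) ω := by
  have h1 := Finset.prod_univ_sum (fun _ : Fin m × Bool => (Finset.univ : Finset (freqBall N × Bool)))
    fun i j => (weight M j.1 * phase i.2 j.2 * expChar (signChar i.2 j.1) x) * zeta (j.1, j.2) ω
  rw [Fintype.piFinset_univ] at h1
  simp only [field_factor h, Finset.prod_mul_distrib] at h1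
  simp only [chaosCoeff, Finset.prod_mul_distrib]
  rw [← h1, Fintype.prod_prod_type]
  simp only [Fintype.prod_bool, Bool.false_eq_true, ↓reduceIte, Finset.prod_const,
    Finset.card_univ, Fintype.card_fin]

/-- The coefficients of the complexified energy. -/
def energyCoeff (m M N : ℕ) (l : Fin m × Bool → freqBall N × Bool) : ℂ :=
  1 / (2 * (m : ℂ)) * ∫ x : Torus, chaosCoeff m M N l x

theorem continuous_chaosCoeff (m M N : ℕ) (l : Fin m × Bool → freqBall N × Bool) :
    Continuous (chaosCoeff m M N l) :=
  continuous_finsetProd _ fun _ _ => continuous_const.mul (continuous_expChar _)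

theorem integrable_monomial_zeta {m N : ℕ} (l : Fin m × Bool → freqBall N × Bool) :
    Integrable (fun ω => ∏ i, zeta ((l i).1, (l i).2) ω) (gaussianFamily.prod gaussianFamily) := by
  have h := (hasGaussianMoments_zeta (freqBall N) (occ l) 0).1
  refine h.congr (ae_of_all _ fun ω => ?_)
  simp only [Pi.zero_apply, pow_zero, mul_one]
  exact (prod_comp_eq_prod_pow_occ l fun j => zeta (j.1, j.2) ω).symm

/-- The energy is the conditional expectation, given g, of the complexified energy. By Fubini the
integrability hypothesis holds for almost every g. -/
theorem energy_eq_integral (m : ℕ) {M N : ℕ} (h : M ≤ N) {g : Freq → ℂ}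
    (hg : ∀ l : Fin m × Bool → freqBall N × Bool,
      Integrable (fun g' => ∏ i, zeta ((l i).1, (l i).2) (g, g')) gaussianFamily) :
    ((energy m M g : ℝ) : ℂ) = ∫ g', ∑ l : Fin m × Bool → freqBall N × Bool,
      energyCoeff m M N l * ∏ i, zeta ((l i).1, (l i).2) (g, g') ∂gaussianFamily := by
  have h1 : ∀ x : Torus, ((wickPoly m (sigma M / 2) (field M g x) : ℝ) : ℂ)
      = ∑ l : Fin m × Bool → freqBall N × Bool, chaosCoeff m M N l x
        * ∫ g', ∏ i, zeta ((l i).1, (l i).2) (g, g') ∂gaussianFamily := by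
    intro x
    rw [wickPoly_field_eq_integral]
    have h2 := fun g' => chaos_expansion m h (g, g') x
    simp only at h2
    simp_rw [h2]
    rw [integral_finsetSum _ fun l _ => (hg l).const_mul _]
    simp_rw [integral_const_mul]
  rw [integral_finsetSum _ fun l _ => (hg l).const_mul _, energy]
  push_cast
  rw [← integral_complex_ofReal]
  simp_rw [h1]
  rw [integral_finsetSum]
  · rw [Finset.mul_sum]
    refine Finset.sum_congr rfl fun l _ => ?_
    rw [integral_mul_const, integral_const_mul, energyCoeff]
    ring
  · intro l _
    exact ((continuous_chaosCoeff m M N l).integrable_of_hasCompactSupport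
      (HasCompactSupport.of_compactSpace _)).mul_const _

/-- Jensen's inequality, used to bound the average over the copy g' by moments on the product space.
-/
theorem lintegral_pow_le_of_isProbabilityMeasure {α : Type*} [MeasurableSpace α] {μ : Measure α}
    [IsProbabilityMeasure μ] {f : α → ℂ} (hf : AEStronglyMeasurable f μ) (k : ℕ) :
    ‖∫ a, f a ∂μ‖ₑ ^ k ≤ ∫⁻ a, ‖f a‖ₑ ^ k ∂μ := by
  rcases Nat.eq_zero_or_pos k with rfl | hk
  · simp
  have hk' : (k : ℝ≥0∞) ≠ 0 := by exact_mod_cast hk.ne'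
  have h1 : ‖∫ a, f a ∂μ‖ₑ ≤ eLpNorm f k μ := by
    refine (enorm_integral_le_lintegral_enorm f).trans ?_
    rw [← eLpNorm_one_eq_lintegral_enorm]
    exact eLpNorm_le_eLpNorm_of_exponent_le (by exact_mod_cast hk) hf
  refine (pow_le_pow_left' h1 k).trans (le_of_eq ?_)
  rw [eLpNorm_eq_lintegral_rpow_enorm_toReal hk' (by simp), ← ENNReal.rpow_natCast,
    ← ENNReal.rpow_mul]
  simp only [ENNReal.toReal_natCast, ENNReal.rpow_natCast]
  rw [one_div, inv_mul_cancel₀ (by exact_mod_cast hk.ne'), ENNReal.rpow_one]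

/-- The moments of the difference of two truncated energies are controlled by the coefficients. -/
theorem lintegral_energy_sub_pow_le (m : ℕ) {M N : ℕ} (h : M ≤ N) (k : ℕ) :
    ∫⁻ g, ‖energy m N g - energy m M g‖ₑ ^ (2 * k) ∂gaussianFamily
      ≤ ENNReal.ofReal ((k * (m * 2)).factorial
        * (∑ l : Fin m × Bool → freqBall N × Bool,
          ‖energyCoeff m N N l - energyCoeff m M N l‖ ^ 2) ^ k) := by
  have h1 := (hasGaussianMoments_zeta (freqBall N)).lintegral_pow_le
    (n := fun l : Fin m × Bool → freqBall N × Bool => l) (fun _ _ h => h)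
    (fun l => energyCoeff m N N l - energyCoeff m M N l) k
  simp only [Fintype.card_prod, Fintype.card_fin, Fintype.card_bool] at h1
  refine le_trans ?_ h1
  have hmeas : Measurable fun ω : (Freq → ℂ) × (Freq → ℂ) =>
      ∑ l : Fin m × Bool → freqBall N × Bool, (energyCoeff m N N l - energyCoeff m M N l)
        * ∏ i, zeta ((l i).1, (l i).2) ω :=
    Finset.measurable_fun_sum _ fun l _ => (Finset.measurable_fun_prod _ fun i _ =>
      measurable_zeta _).const_mul _
  rw [lintegral_prod _ (hmeas.enorm.pow_const _).aemeasurable]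
  refine lintegral_mono_ae ?_
  have hg : ∀ᵐ g ∂gaussianFamily, ∀ l : Fin m × Bool → freqBall N × Bool,
      Integrable (fun g' => ∏ i, zeta ((l i).1, (l i).2) (g, g')) gaussianFamily :=
    ae_all_iff.2 fun l => (integrable_monomial_zeta l).prod_right_ae
  filter_upwards [hg] with g hg
  have h2 : ((energy m N g - energy m M g : ℝ) : ℂ)
      = ∫ g', ∑ l : Fin m × Bool → freqBall N × Bool, (energyCoeff m N N l - energyCoeff m M N l)
        * ∏ i, zeta ((l i).1, (l i).2) (g, g') ∂gaussianFamily := by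
    rw [Complex.ofReal_sub, energy_eq_integral m le_rfl hg, energy_eq_integral m h hg,
      ← integral_sub]
    · simp_rw [sub_mul, Finset.sum_sub_distrib]
    · exact integrable_finsetSum _ fun l _ => (hg l).const_mul _
    · exact integrable_finsetSum _ fun l _ => (hg l).const_mul _
  have h3 : ‖energy m N g - energy m M g‖ₑ = ‖((energy m N g - energy m M g : ℝ) : ℂ)‖ₑ := by
    rw [← ofReal_norm, ← ofReal_norm, Complex.norm_real]
  rw [h3, h2]
  exact lintegral_pow_le_of_isProbabilityMeasure
    (hmeas.comp measurable_prodMk_left).aestronglyMeasurable _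

/-! ### The decay of the coefficients at high frequency -/

/-- The total frequency of a monomial. -/
def totalFreq {m N : ℕ} (l : Fin m × Bool → freqBall N × Bool) : Freq :=
  ∑ i, signChar i.2 (l i).1

theorem chaosCoeff_eq (m M N : ℕ) (l : Fin m × Bool → freqBall N × Bool) (x : Torus) :
    chaosCoeff m M N l x
      = (∏ i, (weight M (l i).1 : ℂ)) * (∏ i : Fin m × Bool, phase i.2 (l i).2)
        * expChar (totalFreq l) x := by
  rw [chaosCoeff, totalFreq, expChar_sum, Finset.prod_mul_distrib, Finset.prod_mul_distrib]

/-- The energy of a single normalized monomial. -/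
def energyNorm (m : ℕ) : ℝ := 1 / (2 * (m : ℝ)) * (volume : Measure Torus).real Set.univ

/-- A nonzero total frequency integrates to zero over the torus. If all frequencies lie in the
smaller ball the coefficients agree; otherwise the one at cutoff M vanishes. -/
theorem norm_energyCoeff_sub_sq_le {m M N : ℕ}
    (l : Fin m × Bool → freqBall N × Bool) :
    ‖energyCoeff m N N l - energyCoeff m M N l‖ ^ 2
      ≤ energyNorm m ^ 2 * (if totalFreq l = 0 ∧ ∃ i, ((l i).1 : Freq) ∉ freqBall M then
        ∏ i, (bracket (l i).1 ^ 2)⁻¹ else 0) := by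
  have h1 : energyCoeff m N N l - energyCoeff m M N l
      = (∏ i, (weight N (l i).1 : ℂ) - ∏ i, (weight M (l i).1 : ℂ))
        * (∏ i : Fin m × Bool, phase i.2 (l i).2)
        * (1 / (2 * (m : ℂ)) * ∫ x : Torus, expChar (totalFreq l) x) := by
    simp only [energyCoeff, chaosCoeff_eq, integral_const_mul]
    ring
  by_cases h2 : totalFreq l = 0
  swap
  · rw [h1, integral_expChar_eq_zero h2]
    simp [h2]
  by_cases h3 : ∃ i, ((l i).1 : Freq) ∉ freqBall M
  swap
  · push Not at h3
    have h4 : ∀ i, weight N (l i).1 = weight M (l i).1 := fun i => by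
      rw [weight, weight, if_pos (h3 i), if_pos (l i).1.2]
    rw [h1]
    simp [h4]
    positivity
  rw [if_pos ⟨h2, h3⟩, h1]
  obtain ⟨i, hi⟩ := h3
  have h4 : ∏ i, (weight M (l i).1 : ℂ) = 0 :=
    Finset.prod_eq_zero (Finset.mem_univ i) (by simp [weight, hi])
  rw [h4, sub_zero, norm_mul, norm_mul, norm_prod, norm_prod]
  simp_rw [norm_phase]
  rw [Finset.prod_const_one, mul_one, mul_pow, ← Finset.prod_pow, mul_comm]
  refine mul_le_mul ?_ ?_ (by positivity) (by positivity)
  · refine pow_le_pow_left₀ (norm_nonneg _) ?_ 2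
    rw [norm_mul, energyNorm]
    refine mul_le_mul (le_of_eq ?_) ?_ (norm_nonneg _) (by positivity)
    · simp
    · refine (norm_integral_le_integral_norm _).trans (le_of_eq ?_)
      simp_rw [norm_expChar]
      simp
  · refine Finset.prod_le_prod (fun _ _ => by positivity) fun i _ => ?_
    rw [Complex.norm_real, Real.norm_of_nonneg (weight_nonneg _ _), ← inv_pow]
    exact pow_le_pow_left₀ (weight_nonneg _ _) (weight_le _ _) 2

theorem one_le_bracket (n : Freq) : 1 ≤ bracket n :=
  Real.one_le_sqrt.2 (by nlinarith [sq_nonneg (n.1 : ℝ), sq_nonneg (n.2 : ℝ)])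

/-- The average of M ≤ ⟨n⟩ and 1 ≤ ⟨n⟩, in a form that stays positive at M = 0. -/
theorem bracket_ge_of_notMem {M : ℕ} {n : Freq} (hn : n ∉ freqBall M) :
    ((M : ℝ) + 1) / 2 ≤ bracket n := by
  rw [mem_freqBall, not_le] at hn
  have h1 : (M : ℝ) ≤ bracket n := hn.le.trans (Real.sqrt_le_sqrt (by linarith))
  have h2 := one_le_bracket n
  linarith

/-- If the largest frequency of a tuple is at least `A`, its weight is at most `A⁻¹` times a
summable weight of the other frequencies. -/
theorem prod_inv_bracket_sq_le {κ : Type*} [Fintype κ] [DecidableEq κ] {d : ℕ} (hd : 0 < d)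
    (ν : κ → Freq) {i₀ : κ} (hi₀ : ∀ i, bracket (ν i) ≤ bracket (ν i₀))
    (hcard : Fintype.card {i // i ≠ i₀} = d) {A : ℝ} (hA : 0 < A) (hle : A ≤ bracket (ν i₀)) :
    ∏ i, (bracket (ν i) ^ 2)⁻¹
      ≤ A⁻¹ * ∏ i : {i // i ≠ i₀}, bracket (ν i) ^ (-2 - 1 / (d : ℝ)) := by
  have hb := bracket_pos
  have hd' : (d : ℝ) ≠ 0 := by exact_mod_cast hd.ne'
  have h0 : ∏ i, (bracket (ν i) ^ 2)⁻¹
      = (bracket (ν i₀) ^ 2)⁻¹ * ∏ i : {i // i ≠ i₀}, (bracket (ν i) ^ 2)⁻¹ := by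
    rw [← Fintype.prod_subtype_mul_prod_subtype (fun i => i = i₀)]
    congr 1
    have : ((default : {i // i = i₀}) : κ) = i₀ := (default : {i // i = i₀}).2
    simp [this]
  -- Of the two inverse powers of the largest bracket, one yields A⁻¹. The other is spread as d-th
  -- roots over the remaining frequencies, lowering their exponents below the summability threshold
  -- -2.
  have h1 : (bracket (ν i₀))⁻¹ ≤ ∏ i : {i // i ≠ i₀}, bracket (ν i) ^ (-1 / (d : ℝ)) := by
    calc (bracket (ν i₀))⁻¹ = ∏ i : {i // i ≠ i₀}, bracket (ν i₀) ^ (-1 / (d : ℝ)) := by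
          rw [Finset.prod_const, Finset.card_univ, hcard, ← Real.rpow_natCast,
            ← Real.rpow_mul (hb _).le, div_mul_cancel₀ _ hd', Real.rpow_neg_one]
      _ ≤ _ := by
          refine Finset.prod_le_prod (fun i _ => Real.rpow_nonneg (hb _).le _) fun i _ => ?_
          refine Real.rpow_le_rpow_of_nonpos (hb _) (hi₀ i) ?_
          rw [neg_div]
          have : 0 ≤ 1 / (d : ℝ) := by positivity
          linarith
  rw [h0, pow_two, mul_inv, mul_assoc]
  refine mul_le_mul (inv_anti₀ hA hle) ?_
    (mul_nonneg (inv_nonneg.2 (hb _).le) (Finset.prod_nonneg fun _ _ => by positivity))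
    (by positivity)
  calc (bracket (ν i₀))⁻¹ * ∏ i : {i // i ≠ i₀}, (bracket (ν i) ^ 2)⁻¹
      ≤ (∏ i : {i // i ≠ i₀}, bracket (ν i) ^ (-1 / (d : ℝ)))
        * ∏ i : {i // i ≠ i₀}, (bracket (ν i) ^ 2)⁻¹ :=
        mul_le_mul_of_nonneg_right h1 (by positivity)
    _ = _ := by
        rw [← Finset.prod_mul_distrib]
        refine Finset.prod_congr rfl fun i _ => ?_
        rw [← Real.rpow_natCast (bracket (ν i)) 2, ← Real.rpow_neg (hb _).le,
          ← Real.rpow_add (hb _)]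
        congr 1
        push_cast
        ring

theorem signChar_injective (b : Bool) : Function.Injective (signChar b) := by
  intro n n' h
  cases b
  · simpa [signChar] using h
  · simpa [signChar] using h

/-- Fixing the total frequency leaves one frequency determined by the others. -/
theorem sum_totalFreq_eq_zero_le {m N : ℕ} (i₀ : Fin m × Bool) {H : Freq → ℝ} (hH : ∀ n, 0 ≤ H n) :
    ∑ l : Fin m × Bool → freqBall N × Bool,
      (if totalFreq l = 0 then ∏ i : {i // i ≠ i₀}, H (l i).1 else 0)
      ≤ 2 * (2 * ∑ n ∈ freqBall N, H n) ^ Fintype.card {i : Fin m × Bool // i ≠ i₀} := by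
  rw [← Finset.sum_filter]
  -- Only the real/imaginary flag at i₀ stays free, whence the outer factor 2; the inner factor 2
  -- counts the flags at the other indices.
  let φ : (Fin m × Bool → freqBall N × Bool) →
      Bool × ({i // i ≠ i₀} → freqBall N × Bool) := fun l => ((l i₀).2, fun i => l i)
  have hinj : Set.InjOn φ (Finset.univ.filter fun l : Fin m × Bool → freqBall N × Bool =>
      totalFreq l = 0) := by
    intro l hl l' hl' hφ
    have h1 := congrArg Prod.fst hφ
    have h2 : ∀ i, i ≠ i₀ → l i = l' i := fun i hi => congrFun (congrArg Prod.snd hφ) ⟨i, hi⟩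
    have hl0 : totalFreq l = 0 := by simpa using hl
    have hl0' : totalFreq l' = 0 := by simpa using hl'
    have h3 : signChar i₀.2 (l i₀).1 = signChar i₀.2 (l' i₀).1 := by
      have h4 := hl0.trans hl0'.symm
      rw [totalFreq, totalFreq, ← Finset.add_sum_erase _ _ (Finset.mem_univ i₀),
        ← Finset.add_sum_erase _ _ (Finset.mem_univ i₀)] at h4
      rw [Finset.sum_congr rfl fun i hi => by rw [h2 i (Finset.ne_of_mem_erase hi)]] at h4
      exact add_right_cancel h4
    funext i
    by_cases hi : i = i₀
    · rw [hi]
      exact Prod.ext (Subtype.ext (signChar_injective _ h3)) h1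
    · exact h2 i hi
  have h5 := Finset.sum_image (f := fun q : Bool × ({i // i ≠ i₀} → freqBall N × Bool) =>
    ∏ i, H (q.2 i).1) hinj
  refine h5.symm.le.trans ?_
  refine (Finset.sum_le_sum_of_subset_of_nonneg (Finset.subset_univ _)
    fun q _ _ => Finset.prod_nonneg fun i _ => hH _).trans (le_of_eq ?_)
  rw [Fintype.sum_prod_type, Fintype.sum_bool, ← two_mul]
  congr 1
  have h6 := pow_card_sum (κ := {i // i ≠ i₀}) fun j : freqBall N × Bool => H j.1
  rw [← h6, Fintype.sum_prod_type]
  simp only [Fintype.sum_bool, ← two_mul]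
  rw [← Finset.mul_sum, Finset.sum_coe_sort (freqBall N) H]

theorem exists_sum_energyCoeff_sub_sq_le (m : ℕ) (hm : 0 < m) :
    ∃ C : ℝ, 0 < C ∧ ∀ M N : ℕ, M ≤ N →
      ∑ l : Fin m × Bool → freqBall N × Bool,
        ‖energyCoeff m N N l - energyCoeff m M N l‖ ^ 2 ≤ C / ((M : ℝ) + 1) := by
  have hcard : ∀ i₀ : Fin m × Bool, Fintype.card {i // i ≠ i₀} = 2 * m - 1 := by
    intro i₀
    rw [Fintype.card_subtype_compl, Fintype.card_prod, Fintype.card_fin, Fintype.card_bool,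
      Fintype.card_unique, mul_comm]
  have hd : 0 < 2 * m - 1 := by omega
  set H : Freq → ℝ := fun n => bracket n ^ (-2 - 1 / ((2 * m - 1 : ℕ) : ℝ)) with hHdef
  have hH : ∀ n, 0 ≤ H n := fun n => Real.rpow_nonneg (bracket_pos n).le _
  have hHs : Summable H := summable_bracket (by
    have : 0 < 1 / ((2 * m - 1 : ℕ) : ℝ) := by positivity
    linarith)
  set S := ∑' n, H n with hS
  have hS0 : 0 ≤ S := tsum_nonneg hH
  -- There are 2m choices for the position of the largest frequency; one factor 2 inverts the half
  -- in (M+1)/2, and 2(2S)^(2m-1) comes from `sum_totalFreq_eq_zero_le`. The added 1 ensures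
  -- positivity.
  refine ⟨energyNorm m ^ 2 * ((2 * m : ℕ) * (2 * (2 * (2 * S) ^ (2 * m - 1)))) + 1, by positivity,
    fun M N h => ?_⟩
  have hM : (0 : ℝ) < ((M : ℝ) + 1) / 2 := by positivity
  have h1 : ∀ l : Fin m × Bool → freqBall N × Bool,
      (if totalFreq l = 0 ∧ ∃ i, ((l i).1 : Freq) ∉ freqBall M then
        ∏ i, (bracket (l i).1 ^ 2)⁻¹ else 0)
      ≤ ∑ i₀ : Fin m × Bool, (((M : ℝ) + 1) / 2)⁻¹ *
        (if totalFreq l = 0 then ∏ i : {i // i ≠ i₀}, H (l i).1 else 0) := by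
    intro l
    have hnn : ∀ i₀ : Fin m × Bool, 0 ≤ (((M : ℝ) + 1) / 2)⁻¹ *
        (if totalFreq l = 0 then ∏ i : {i // i ≠ i₀}, H (l i).1 else 0) := by
      intro i₀
      refine mul_nonneg (by positivity) ?_
      split_ifs
      · exact Finset.prod_nonneg fun i _ => hH _
      · exact le_rfl
    by_cases hl : totalFreq l = 0 ∧ ∃ i, ((l i).1 : Freq) ∉ freqBall M
    · rw [if_pos hl]
      obtain ⟨hl0, j, hj⟩ := hl
      obtain ⟨i₀, -, hi₀⟩ := Finset.exists_max_image Finset.univ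
        (fun i => bracket (l i).1) ⟨j, Finset.mem_univ j⟩
      have h2 := prod_inv_bracket_sq_le hd (fun i => ((l i).1 : Freq))
        (fun i => hi₀ i (Finset.mem_univ i)) (hcard i₀) hM
        ((bracket_ge_of_notMem hj).trans (hi₀ j (Finset.mem_univ j)))
      refine h2.trans ?_
      have h3 := Finset.single_le_sum (f := fun i₀ : Fin m × Bool => (((M : ℝ) + 1) / 2)⁻¹ *
        (if totalFreq l = 0 then ∏ i : {i // i ≠ i₀}, H (l i).1 else 0))
        (fun i _ => hnn i) (Finset.mem_univ i₀)
      simp only [if_pos hl0] at h3 ⊢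
      exact h3
    · rw [if_neg hl]
      exact Finset.sum_nonneg fun i _ => hnn i
  have h2 : ∀ i₀ : Fin m × Bool, ∑ l : Fin m × Bool → freqBall N × Bool,
      (if totalFreq l = 0 then ∏ i : {i // i ≠ i₀}, H (l i).1 else 0)
      ≤ 2 * (2 * S) ^ (2 * m - 1) := by
    intro i₀
    refine (sum_totalFreq_eq_zero_le i₀ hH).trans ?_
    rw [hcard]
    have h3 : ∑ n ∈ freqBall N, H n ≤ S := hHs.sum_le_tsum _ fun n _ => hH n
    have h4 : 0 ≤ ∑ n ∈ freqBall N, H n := Finset.sum_nonneg fun n _ => hH n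
    gcongr
  calc ∑ l : Fin m × Bool → freqBall N × Bool,
        ‖energyCoeff m N N l - energyCoeff m M N l‖ ^ 2
      ≤ ∑ l : Fin m × Bool → freqBall N × Bool, energyNorm m ^ 2 *
        ∑ i₀ : Fin m × Bool, (((M : ℝ) + 1) / 2)⁻¹ *
        (if totalFreq l = 0 then ∏ i : {i // i ≠ i₀}, H (l i).1 else 0) :=
        Finset.sum_le_sum fun l _ => (norm_energyCoeff_sub_sq_le l).trans
          (mul_le_mul_of_nonneg_left (h1 l) (by positivity))
    _ = energyNorm m ^ 2 * ∑ i₀ : Fin m × Bool, (((M : ℝ) + 1) / 2)⁻¹ *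
        ∑ l : Fin m × Bool → freqBall N × Bool,
        (if totalFreq l = 0 then ∏ i : {i // i ≠ i₀}, H (l i).1 else 0) := by
        rw [← Finset.mul_sum, Finset.sum_comm]
        simp_rw [Finset.mul_sum]
    _ ≤ energyNorm m ^ 2 * ∑ i₀ : Fin m × Bool, (((M : ℝ) + 1) / 2)⁻¹ *
        (2 * (2 * S) ^ (2 * m - 1)) := by
        refine mul_le_mul_of_nonneg_left (Finset.sum_le_sum fun i₀ _ => ?_) (by positivity)
        exact mul_le_mul_of_nonneg_left (h2 i₀) (by positivity)
    _ = energyNorm m ^ 2 * ((2 * m : ℕ) * (2 * (2 * (2 * S) ^ (2 * m - 1)))) / ((M : ℝ) + 1) := by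
        rw [Finset.sum_const, Finset.card_univ, Fintype.card_prod, Fintype.card_fin,
          Fintype.card_bool, mul_comm m 2, nsmul_eq_mul, inv_div]
        ring
    _ ≤ _ := by
        gcongr
        linarith

/-! ### The lower bound for the truncated energy -/

/-- The true growth is logarithmic, but any small power suffices: ⟨n⟩^(-2) = ⟨n⟩^(-2-ε) ⟨n⟩^ε, where
the first factor is summable and ⟨n⟩ ≤ N + 1. -/
theorem exists_sigma_le {ε : ℝ} (hε : 0 < ε) :
    ∃ C : ℝ, 0 < C ∧ ∀ N : ℕ, sigma N ≤ C * ((N : ℝ) + 1) ^ ε := by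
  have hs : Summable fun n => bracket n ^ (-2 - ε) := summable_bracket (by linarith)
  have hnn : ∀ n, 0 ≤ bracket n ^ (-2 - ε) := fun n => Real.rpow_nonneg (bracket_pos n).le _
  have h0 : 0 ≤ ∑' n, bracket n ^ (-2 - ε) := tsum_nonneg hnn
  refine ⟨(∑' n, bracket n ^ (-2 - ε)) + 1, by linarith, fun N => ?_⟩
  have hN : (0 : ℝ) ≤ ((N : ℝ) + 1) ^ ε := by positivity
  calc sigma N = ∑ n ∈ freqBall N, bracket n ^ (-2 - ε) * bracket n ^ ε := by
        rw [sigma_eq]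
        refine Finset.sum_congr rfl fun n _ => ?_
        rw [← Real.rpow_natCast (bracket n) 2, ← Real.rpow_neg (bracket_pos n).le,
          ← Real.rpow_add (bracket_pos n)]
        congr 1
        push_cast
        ring
    _ ≤ ∑ n ∈ freqBall N, bracket n ^ (-2 - ε) * ((N : ℝ) + 1) ^ ε := by
        refine Finset.sum_le_sum fun n hn => mul_le_mul_of_nonneg_left ?_ (hnn n)
        refine Real.rpow_le_rpow (bracket_pos n).le ?_ hε.le
        rw [mem_freqBall, Real.sqrt_le_left (by positivity)] at hn
        refine (Real.sqrt_le_left (by positivity)).2 ?_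
        have : (0 : ℝ) ≤ N := by positivity
        nlinarith
    _ ≤ (∑' n, bracket n ^ (-2 - ε)) * ((N : ℝ) + 1) ^ ε := by
        rw [← Finset.sum_mul]
        exact mul_le_mul_of_nonneg_right (hs.sum_le_tsum _ fun n _ => hnn n) hN
    _ ≤ _ := mul_le_mul_of_nonneg_right (by linarith) hN

/-- The Hermite polynomial is monic, so the difference has lower degree. The missing degree appears
as a factor y on the left, which avoids the exponent k - 1. -/
theorem exists_abs_aeval_hermite_sub_pow_le (k : ℕ) :
    ∃ C : ℝ, 0 ≤ C ∧ ∀ x y : ℝ, 1 + |x| ≤ y →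
      |Polynomial.aeval x (Polynomial.hermite k) - x ^ k| * y ≤ C * y ^ k := by
  refine ⟨∑ i ∈ Finset.range k, |((Polynomial.hermite k).coeff i : ℝ)|,
    Finset.sum_nonneg fun _ _ => abs_nonneg _, fun x y hxy => ?_⟩
  have hy : 1 ≤ y := by linarith [abs_nonneg x]
  have h1 : Polynomial.aeval x (Polynomial.hermite k) - x ^ k
      = ∑ i ∈ Finset.range k, ((Polynomial.hermite k).coeff i : ℝ) * x ^ i := by
    rw [Polynomial.aeval_eq_sum_range, Polynomial.natDegree_hermite, Finset.sum_range_succ,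
      Polynomial.coeff_hermite_self, one_smul, add_sub_cancel_right]
    refine Finset.sum_congr rfl fun i _ => ?_
    rw [zsmul_eq_mul]
  rw [h1, Finset.sum_mul]
  calc |∑ i ∈ Finset.range k, ((Polynomial.hermite k).coeff i : ℝ) * x ^ i| * y
      ≤ (∑ i ∈ Finset.range k, |((Polynomial.hermite k).coeff i : ℝ)| * |x| ^ i) * y := by
        refine mul_le_mul_of_nonneg_right ((Finset.abs_sum_le_sum_abs _ _).trans (le_of_eq ?_))
          (by linarith)
        simp_rw [abs_mul, abs_pow]
    _ = ∑ i ∈ Finset.range k, |((Polynomial.hermite k).coeff i : ℝ)| * (|x| ^ i * y) := by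
        rw [Finset.sum_mul]
        simp_rw [mul_assoc]
    _ ≤ _ := by
        refine Finset.sum_le_sum fun i hi => mul_le_mul_of_nonneg_left ?_ (abs_nonneg _)
        have h2 : |x| ^ i ≤ y ^ i := pow_le_pow_left₀ (abs_nonneg x) (by linarith) i
        calc |x| ^ i * y ≤ y ^ i * y := mul_le_mul_of_nonneg_right h2 (by linarith)
          _ = y ^ (i + 1) := (pow_succ y i).symm
          _ ≤ y ^ k := pow_le_pow_right₀ hy (Finset.mem_range.1 hi)

theorem exists_abs_hermite_mul_hermite_sub_le (a b : ℕ) :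
    ∃ C : ℝ, 0 ≤ C ∧ ∀ s t y : ℝ, 1 + |s| + |t| ≤ y →
      |Polynomial.aeval s (Polynomial.hermite a) * Polynomial.aeval t (Polynomial.hermite b)
        - s ^ a * t ^ b| * y ≤ C * y ^ (a + b) := by
  obtain ⟨A, hA, hA'⟩ := exists_abs_aeval_hermite_sub_pow_le a
  obtain ⟨B, hB, hB'⟩ := exists_abs_aeval_hermite_sub_pow_le b
  refine ⟨A * (1 + B) + B, by positivity, fun s t y h => ?_⟩
  have hs0 := abs_nonneg s
  have ht0 := abs_nonneg t
  have hy : 1 ≤ y := by linarith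
  have hy0 : 0 ≤ y := by linarith
  have h1 := hA' s y (by linarith)
  have h2 := hB' t y (by linarith)
  set P : ℝ := Polynomial.aeval s (Polynomial.hermite a)
  set Q : ℝ := Polynomial.aeval t (Polynomial.hermite b)
  have h3 : |s ^ a| ≤ y ^ a := by
    rw [abs_pow]
    exact pow_le_pow_left₀ hs0 (by linarith) a
  have h4 : |t ^ b| ≤ y ^ b := by
    rw [abs_pow]
    exact pow_le_pow_left₀ ht0 (by linarith) b
  have h5 : |Q| ≤ (1 + B) * y ^ b := by
    have h6 : |Q - t ^ b| ≤ |Q - t ^ b| * y := le_mul_of_one_le_right (abs_nonneg _) hy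
    have h7 : |Q| ≤ |Q - t ^ b| + |t ^ b| := by simpa using abs_add_le (Q - t ^ b) (t ^ b)
    linarith
  have h6 : |P * Q - s ^ a * t ^ b| ≤ |P - s ^ a| * |Q| + |s ^ a| * |Q - t ^ b| := by
    rw [← abs_mul, ← abs_mul]
    refine le_trans (le_of_eq ?_) (abs_add_le _ _)
    congr 1
    ring
  calc |P * Q - s ^ a * t ^ b| * y
      ≤ (|P - s ^ a| * |Q| + |s ^ a| * |Q - t ^ b|) * y := mul_le_mul_of_nonneg_right h6 hy0
    _ = (|P - s ^ a| * y) * |Q| + |s ^ a| * (|Q - t ^ b| * y) := by ring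
    _ ≤ (A * y ^ a) * ((1 + B) * y ^ b) + y ^ a * (B * y ^ b) := by gcongr
    _ = _ := by ring

/-- The leading part (s² + t²)^m is nonnegative and dominates the lower-order terms at infinity. -/
theorem exists_neg_le_sum_hermite (m : ℕ) :
    ∃ K : ℝ, 0 ≤ K ∧ ∀ s t : ℝ, -K ≤ ∑ l ∈ Finset.range (m + 1), (m.choose l : ℝ) *
      (Polynomial.aeval s (Polynomial.hermite (2 * l))
        * Polynomial.aeval t (Polynomial.hermite (2 * (m - l)))) := by
  choose C hC hC' using exists_abs_hermite_mul_hermite_sub_le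
  set D : ℝ := ∑ l ∈ Finset.range (m + 1), (m.choose l : ℝ) * C (2 * l) (2 * (m - l)) with hD
  have hD0 : 0 ≤ D := Finset.sum_nonneg fun l _ => mul_nonneg (by positivity) (hC _ _)
  -- Threshold for y = 1 + |s| + |t|: y ≥ 3 gives s² + t² ≥ y²/6, and y ≥ D 6^m makes the error at
  -- most the leading part. Below the threshold the error itself is bounded.
  refine ⟨D * (3 + D * 6 ^ m) ^ (2 * m), by positivity, fun s t => ?_⟩
  set Q := ∑ l ∈ Finset.range (m + 1), (m.choose l : ℝ) *
      (Polynomial.aeval s (Polynomial.hermite (2 * l))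
        * Polynomial.aeval t (Polynomial.hermite (2 * (m - l)))) with hQ
  set y := 1 + |s| + |t| with hy
  have hs0 := abs_nonneg s
  have ht0 := abs_nonneg t
  have hy1 : 1 ≤ y := by linarith
  have h1 : |Q - (s ^ 2 + t ^ 2) ^ m| * y ≤ D * y ^ (2 * m) := by
    have h2 : Q - (s ^ 2 + t ^ 2) ^ m = ∑ l ∈ Finset.range (m + 1), (m.choose l : ℝ) *
      (Polynomial.aeval s (Polynomial.hermite (2 * l))
        * Polynomial.aeval t (Polynomial.hermite (2 * (m - l)))
          - s ^ (2 * l) * t ^ (2 * (m - l))) := by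
      rw [add_pow, hQ, ← Finset.sum_sub_distrib]
      refine Finset.sum_congr rfl fun l _ => ?_
      rw [pow_mul, pow_mul]
      ring
    rw [h2, hD, Finset.sum_mul]
    refine (mul_le_mul_of_nonneg_right (Finset.abs_sum_le_sum_abs _ _) (by linarith)).trans ?_
    rw [Finset.sum_mul]
    refine Finset.sum_le_sum fun l hl => ?_
    have h3 := hC' (2 * l) (2 * (m - l)) s t y le_rfl
    have h4 : 2 * l + 2 * (m - l) = 2 * m := by
      have := Finset.mem_range.1 hl
      omega
    rw [h4] at h3
    rw [abs_mul, Nat.abs_cast, mul_assoc, mul_assoc]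
    exact mul_le_mul_of_nonneg_left h3 (by positivity)
  have hr : 0 ≤ (s ^ 2 + t ^ 2) ^ m := by positivity
  have hab := neg_abs_le (Q - (s ^ 2 + t ^ 2) ^ m)
  by_cases hyY : y ≤ 3 + D * 6 ^ m
  · have h2 : D * y ^ (2 * m) ≤ D * (3 + D * 6 ^ m) ^ (2 * m) := by gcongr
    have h3 : |Q - (s ^ 2 + t ^ 2) ^ m| ≤ |Q - (s ^ 2 + t ^ 2) ^ m| * y :=
      le_mul_of_one_le_right (abs_nonneg _) hy1
    linarith
  · rw [not_le] at hyY
    have h60 : 0 ≤ D * 6 ^ m := by positivity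
    have h2 : y ^ 2 / 6 ≤ s ^ 2 + t ^ 2 := by
      have h3 : 3 ≤ y := by linarith
      rw [← sq_abs s, ← sq_abs t]
      nlinarith [sq_nonneg (|s| - |t|), sq_nonneg (|s| - 1), sq_nonneg (|t| - 1)]
    have h3 : y ^ (2 * m) / 6 ^ m ≤ (s ^ 2 + t ^ 2) ^ m := by
      rw [pow_mul, ← div_pow]
      exact pow_le_pow_left₀ (by positivity) h2 m
    have h4 : D * y ^ (2 * m) ≤ y ^ (2 * m) / 6 ^ m * y := by
      have h5 : D ≤ y / 6 ^ m := by
        rw [le_div_iff₀ (by positivity)]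
        linarith
      calc D * y ^ (2 * m) ≤ y / 6 ^ m * y ^ (2 * m) := by gcongr
        _ = _ := by ring
    have h5 : |Q - (s ^ 2 + t ^ 2) ^ m| * y ≤ (s ^ 2 + t ^ 2) ^ m * y := by
      refine h1.trans (h4.trans ?_)
      gcongr
    have h6 := le_of_mul_le_mul_right h5 (by linarith)
    have h7 : 0 ≤ D * (3 + D * 6 ^ m) ^ (2 * m) := by positivity
    linarith

theorem exists_neg_le_wickPoly (m : ℕ) :
    ∃ K : ℝ, 0 ≤ K ∧ ∀ (v : ℝ) (w : ℂ), 0 < v → -(K * v ^ m) ≤ wickPoly m v w := by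
  obtain ⟨K, hK, h⟩ := exists_neg_le_sum_hermite m
  refine ⟨K, hK, fun v w hv => ?_⟩
  have h1 : wickPoly m v w = v ^ m * ∑ l ∈ Finset.range (m + 1), (m.choose l : ℝ) *
      (Polynomial.aeval (w.re / √v) (Polynomial.hermite (2 * l))
        * Polynomial.aeval (w.im / √v) (Polynomial.hermite (2 * (m - l)))) := by
    rw [wickPoly, Finset.mul_sum]
    refine Finset.sum_congr rfl fun l hl => ?_
    have h2 : v ^ m = √v ^ (2 * l) * √v ^ (2 * (m - l)) := by
      rw [pow_mul, pow_mul, Real.sq_sqrt hv.le, ← pow_add]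
      congr 1
      have := Finset.mem_range.1 hl
      omega
    rw [h2, hermiteVar, hermiteVar]
    ring
  rw [h1, mul_comm K, ← mul_neg]
  exact mul_le_mul_of_nonneg_left (h _ _) (by positivity)

theorem continuous_hermiteVar (k : ℕ) (v : ℝ) : Continuous (hermiteVar k v) :=
  continuous_const.mul ((Polynomial.continuous_aeval _).comp (continuous_id.div_const _))

theorem continuous_wickPoly (m : ℕ) (v : ℝ) : Continuous (wickPoly m v) :=
  continuous_finsetSum _ fun _ _ => continuous_const.mul
    (((continuous_hermiteVar _ _).comp Complex.continuous_re).mul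
      ((continuous_hermiteVar _ _).comp Complex.continuous_im))

theorem continuous_field (N : ℕ) (g : Freq → ℂ) : Continuous (field N g) :=
  continuous_finsetSum _ fun n _ => ((continuous_expChar n).div_const _).mul continuous_const

theorem measurable_energy (m N : ℕ) : Measurable (energy m N) := by
  have h1 : Measurable fun q : (Freq → ℂ) × Torus => field N q.1 q.2 := by
    refine Finset.measurable_fun_sum _ fun n _ => ?_
    have := (continuous_expChar n).measurable
    exact ((this.comp measurable_snd).div_const _).mul
      ((measurable_pi_apply n).comp measurable_fst)
  have h2 : Measurable fun q : (Freq → ℂ) × Torus => wickPoly m (sigma N / 2) (field N q.1 q.2) :=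
    (continuous_wickPoly _ _).measurable.comp h1
  exact (h2.stronglyMeasurable.integral_prod_right (ν := volume)).measurable.const_mul _

theorem exists_neg_le_energy {m : ℕ} (hm : 0 < m) :
    ∃ C : ℝ, 0 < C ∧ ∀ (N : ℕ) (g : Freq → ℂ),
      -energy m N g ≤ C * ((N : ℝ) + 1) ^ (1 / (8 * (m : ℝ))) := by
  have hm' : (0 : ℝ) < m := by exact_mod_cast hm
  obtain ⟨K, hK, h⟩ := exists_neg_le_wickPoly m
  -- The m-th power of σ_N turns the exponent 1/(8m²) into 1/(8m).
  obtain ⟨S, hS, h'⟩ := exists_sigma_le (ε := 1 / (8 * (m : ℝ) ^ 2)) (by positivity)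
  have hE : 0 ≤ energyNorm m := by
    unfold energyNorm
    positivity
  refine ⟨energyNorm m * (K * S ^ m) + 1, by positivity, fun N g => ?_⟩
  have hint : Integrable (fun x : Torus => wickPoly m (sigma N / 2) (field N g x)) :=
    ((continuous_wickPoly _ _).comp (continuous_field N g)).integrable_of_hasCompactSupport
      (HasCompactSupport.of_compactSpace _)
  have h1 : -(energyNorm m * (K * (sigma N / 2) ^ m)) ≤ energy m N g := by
    have h2 := integral_mono (integrable_const (μ := (volume : Measure Torus))
      (-(K * (sigma N / 2) ^ m))) hint
      fun x => h (sigma N / 2) (field N g x) (by have := sigma_pos N; positivity)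
    rw [integral_const, smul_eq_mul] at h2
    rw [energy, energyNorm]
    have h3 : 0 ≤ 1 / (2 * (m : ℝ)) := by positivity
    have h4 := mul_le_mul_of_nonneg_left h2 h3
    linarith
  have h2 : (sigma N / 2) ^ m ≤ S ^ m * ((N : ℝ) + 1) ^ (1 / (8 * (m : ℝ))) := by
    have h3 : sigma N / 2 ≤ S * ((N : ℝ) + 1) ^ (1 / (8 * (m : ℝ) ^ 2)) := by
      linarith [h' N, sigma_pos N]
    refine (pow_le_pow_left₀ (by linarith [sigma_pos N]) h3 m).trans (le_of_eq ?_)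
    rw [mul_pow, ← Real.rpow_natCast (((N : ℝ) + 1) ^ (1 / (8 * (m : ℝ) ^ 2))),
      ← Real.rpow_mul (by positivity)]
    congr 2
    field_simp
  have h3 : (0 : ℝ) ≤ ((N : ℝ) + 1) ^ (1 / (8 * (m : ℝ))) := by positivity
  have h4 : energyNorm m * (K * (sigma N / 2) ^ m)
      ≤ energyNorm m * (K * (S ^ m * ((N : ℝ) + 1) ^ (1 / (8 * (m : ℝ))))) := by gcongr
  linarith

/-! ### Uniform exponential integrability -/

theorem exists_lintegral_energy_sub_pow_le {m : ℕ} (hm : 0 < m) :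
    ∃ C : ℝ, 0 < C ∧ ∀ M N : ℕ, M ≤ N → ∀ k : ℕ,
      ∫⁻ g, ‖energy m N g - energy m M g‖ₑ ^ (2 * k) ∂gaussianFamily
        ≤ ENNReal.ofReal ((2 * m * k).factorial * (C / ((M : ℝ) + 1)) ^ k) := by
  obtain ⟨C, hC, h⟩ := exists_sum_energyCoeff_sub_sq_le m hm
  refine ⟨C, hC, fun M N hMN k => (lintegral_energy_sub_pow_le m hMN k).trans ?_⟩
  refine ENNReal.ofReal_le_ofReal ?_
  rw [show k * (m * 2) = 2 * m * k by ring]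
  refine mul_le_mul_of_nonneg_left ?_ (by positivity)
  exact pow_le_pow_left₀ (Finset.sum_nonneg fun _ _ => by positivity) (h M N hMN) k

/-- The Chebyshev bound at exponent 2j, level j/2 and cutoff j^(4m). By n! ≤ n^n the left side is at
most c^j j^(-(2m+2)j), which beats 1/j!. -/
theorem factorial_mul_pow_le {m j : ℕ} (hm : 2 ≤ m) (hj : 0 < j) {C : ℝ} (hC : 0 < C) :
    ((2 * m * j).factorial * (C / (((j ^ (4 * m) : ℕ) : ℝ) + 1)) ^ j) / ((j : ℝ) / 2) ^ (2 * j)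
      ≤ (4 * (2 * m : ℝ) ^ (2 * m) * C) ^ j / j.factorial := by
  have hj' : (0 : ℝ) < j := by exact_mod_cast hj
  have hj1 : (1 : ℝ) ≤ j := by exact_mod_cast hj
  have h1 : ((2 * m * j).factorial : ℝ) ≤ ((2 * m : ℝ) ^ (2 * m) * (j : ℝ) ^ (2 * m)) ^ j := by
    rw [← mul_pow, ← pow_mul]
    exact_mod_cast Nat.factorial_le_pow (2 * m * j)
  have h2 : (j.factorial : ℝ) ≤ (j : ℝ) ^ j := by exact_mod_cast Nat.factorial_le_pow j
  have h3 : C / (((j ^ (4 * m) : ℕ) : ℝ) + 1) ≤ C / (j : ℝ) ^ (4 * m) := by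
    push_cast
    gcongr
    linarith
  have h4 : 0 ≤ C / (((j ^ (4 * m) : ℕ) : ℝ) + 1) := by positivity
  rw [div_le_div_iff₀ (by positivity) (by positivity)]
  calc ((2 * m * j).factorial * (C / (((j ^ (4 * m) : ℕ) : ℝ) + 1)) ^ j) * (j.factorial : ℝ)
      ≤ (((2 * m : ℝ) ^ (2 * m) * (j : ℝ) ^ (2 * m)) ^ j * (C / (j : ℝ) ^ (4 * m)) ^ j)
        * (j : ℝ) ^ j := by gcongr
    _ = ((2 * m : ℝ) ^ (2 * m) * C * ((j : ℝ) ^ (2 * m + 1) / (j : ℝ) ^ (4 * m))) ^ j := by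
        rw [← mul_pow, ← mul_pow]
        congr 1
        ring
    _ ≤ ((2 * m : ℝ) ^ (2 * m) * C * (j : ℝ) ^ 2) ^ j := by
        gcongr
        rw [div_le_iff₀ (by positivity), ← pow_add]
        exact pow_le_pow_right₀ hj1 (by omega)
    _ = (4 * (2 * m : ℝ) ^ (2 * m) * C) ^ j * ((j : ℝ) / 2) ^ (2 * j) := by
        rw [pow_mul ((j : ℝ) / 2), ← mul_pow]
        congr 1
        ring

/-- Nelson's tail estimate. -/
theorem exists_measure_le_neg_energy_le {m : ℕ} (hm : 2 ≤ m) :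
    ∃ (C : ℝ) (j₀ : ℕ), 0 < C ∧ ∀ j, j₀ ≤ j → ∀ N,
      gaussianFamily {g | (j : ℝ) ≤ -energy m N g} ≤ ENNReal.ofReal (C ^ j / j.factorial) := by
  obtain ⟨C, hC, h⟩ := exists_lintegral_energy_sub_pow_le (m := m) (by omega)
  obtain ⟨K, hK, hlow⟩ := exists_neg_le_energy (m := m) (by omega)
  -- The threshold on j gives 4K ≤ √j, hence K · 2√j ≤ j/2 in `hsmall`.
  refine ⟨4 * (2 * m : ℝ) ^ (2 * m) * C, ⌈(4 * K) ^ 2⌉₊ + 1, by positivity, fun j hj N => ?_⟩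
  have hj0 : 0 < j := by omega
  have hj' : (0 : ℝ) < j := by exact_mod_cast hj0
  have hj1 : (1 : ℝ) ≤ j := by exact_mod_cast hj0
  have hm' : (0 : ℝ) < m := by exact_mod_cast (by omega : 0 < m)
  have hm2 : (2 : ℝ) ≤ m := by exact_mod_cast hm
  have hjK : 4 * K ≤ √j := by
    refine Real.le_sqrt_of_sq_le ?_
    have h1 := Nat.le_ceil ((4 * K) ^ 2)
    have h2 : ((⌈(4 * K) ^ 2⌉₊ : ℕ) : ℝ) ≤ j := by exact_mod_cast (by omega)
    linarith
  -- For M ≤ j^(4m) the lower bound, with exponent 1/(8m), is of order √j: at such cutoffs the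
  -- energy cannot reach even half the level.
  have hsmall : ∀ (M : ℕ) (g : Freq → ℂ), M ≤ j ^ (4 * m) → -energy m M g ≤ (j : ℝ) / 2 := by
    intro M g hM
    refine (hlow M g).trans ?_
    have h1 : ((M : ℝ) + 1) ≤ 2 * (j : ℝ) ^ (4 * m) := by
      have h2 : (M : ℝ) ≤ (j : ℝ) ^ (4 * m) := by exact_mod_cast hM
      have h3 : (1 : ℝ) ≤ (j : ℝ) ^ (4 * m) := one_le_pow₀ hj1
      linarith
    have h2 : ((M : ℝ) + 1) ^ (1 / (8 * (m : ℝ))) ≤ 2 * √j := by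
      have he : (0 : ℝ) ≤ 1 / (8 * (m : ℝ)) := by positivity
      refine (Real.rpow_le_rpow (by positivity) h1 he).trans ?_
      rw [Real.mul_rpow (by norm_num) (by positivity), ← Real.rpow_natCast (j : ℝ),
        ← Real.rpow_mul hj'.le, Real.sqrt_eq_rpow]
      have h3 : ((4 * m : ℕ) : ℝ) * (1 / (8 * (m : ℝ))) = 1 / 2 := by
        push_cast
        field_simp
        norm_num
      rw [h3]
      refine mul_le_mul_of_nonneg_right ?_ (by positivity)
      calc (2 : ℝ) ^ (1 / (8 * (m : ℝ))) ≤ (2 : ℝ) ^ (1 : ℝ) := by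
            refine Real.rpow_le_rpow_of_exponent_le (by norm_num) ?_
            rw [div_le_one (by positivity)]
            linarith
        _ = 2 := Real.rpow_one 2
    have h3 : √(j : ℝ) * √j = j := Real.mul_self_sqrt hj'.le
    have h4 : 0 ≤ √(j : ℝ) := Real.sqrt_nonneg _
    nlinarith
  rcases le_or_gt N (j ^ (4 * m)) with hN | hN
  · have : {g | (j : ℝ) ≤ -energy m N g} = ∅ := by
      ext g
      simp only [Set.mem_ofPred_eq, Set.mem_empty_iff_false, iff_false, not_le]
      linarith [hsmall N g hN]
    rw [this]
    simp
  -- Beyond the cutoff j^(4m) the energy has to drop by at least j/2 between the two cutoffs; the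
  -- moment order 2j grows with the level.
  · have hsub : {g | (j : ℝ) ≤ -energy m N g}
        ⊆ {g | ENNReal.ofReal (((j : ℝ) / 2) ^ (2 * j))
          ≤ ‖energy m N g - energy m (j ^ (4 * m)) g‖ₑ ^ (2 * j)} := by
      intro g hg
      simp only [Set.mem_ofPred_eq] at hg ⊢
      have h1 := hsmall (j ^ (4 * m)) g le_rfl
      rw [ENNReal.ofReal_pow (by positivity)]
      refine pow_le_pow_left' ?_ _
      rw [← ofReal_norm]
      refine ENNReal.ofReal_le_ofReal ?_
      rw [Real.norm_eq_abs]
      refine le_trans ?_ (neg_le_abs _)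
      linarith
    refine (measure_mono hsub).trans ?_
    have hpos : 0 < ((j : ℝ) / 2) ^ (2 * j) := by positivity
    refine (meas_ge_le_lintegral_div ?_ ?_ ENNReal.ofReal_ne_top).trans ?_
    · exact ((((measurable_energy m N).sub (measurable_energy m _)).enorm).pow_const _).aemeasurable
    · exact (ENNReal.ofReal_pos.2 hpos).ne'
    · refine (ENNReal.div_le_div_right (h _ _ hN.le j) _).trans ?_
      rw [← ENNReal.ofReal_div_of_pos hpos]
      exact ENNReal.ofReal_le_ofReal (factorial_mul_pow_le hm hj0 hC)

/-- Nelson's estimate: the Boltzmann factors are bounded in every `L^p`. -/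
theorem exists_lintegral_exp_neg_energy_le {m : ℕ} (hm : 2 ≤ m) (p : ℝ) (hp : 0 ≤ p) :
    ∃ K : ℝ≥0∞, K ≠ ∞ ∧ ∀ N,
      ∫⁻ g, ENNReal.ofReal (Real.exp (p * -energy m N g)) ∂gaussianFamily ≤ K := by
  obtain ⟨C, j₀, hC, h⟩ := exists_measure_le_neg_energy_le hm
  -- Below j₀ the trivial bound 1 on a probability is used.
  let b : ℕ → ℝ := fun j => (if j < j₀ then 1 else 0) + C ^ j / j.factorial
  have hb : ∀ j, 0 ≤ b j := fun j => add_nonneg (by split_ifs <;> norm_num) (by positivity)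
  have hbm : ∀ j N : ℕ, gaussianFamily {g | (j : ℝ) ≤ -energy m N g} ≤ ENNReal.ofReal (b j) := by
    intro j N
    have h0 : 0 ≤ C ^ j / j.factorial := by positivity
    by_cases hj : j < j₀
    · refine prob_le_one.trans ?_
      rw [← ENNReal.ofReal_one]
      refine ENNReal.ofReal_le_ofReal ?_
      simp only [b, if_pos hj]
      linarith
    · refine (h j (not_lt.1 hj) N).trans (ENNReal.ofReal_le_ofReal ?_)
      simp only [b, if_neg hj]
      linarith
  have hsum : Summable fun j : ℕ => Real.exp (p * (j + 1)) * b j := by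
    have h1 : Summable fun j : ℕ => Real.exp (p * (j + 1)) * (if j < j₀ then 1 else 0) := by
      refine summable_of_hasFiniteSupport ((Set.finite_lt_nat j₀).subset fun j hj => ?_)
      by_contra hj'
      exact hj (by simp only [Set.mem_ofPred_eq] at hj'; simp [hj'])
    have h2 : Summable fun j : ℕ => Real.exp (p * (j + 1)) * (C ^ j / j.factorial) := by
      refine ((Real.summable_pow_div_factorial (Real.exp p * C)).mul_left (Real.exp p)).congr
        fun j => ?_
      rw [mul_add, mul_one, Real.exp_add, mul_comm p, Real.exp_nat_mul, mul_pow]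
      ring
    refine (h1.add h2).congr fun j => ?_
    simp only [b]
    ring
  refine ⟨1 + ∑' j : ℕ, ENNReal.ofReal (Real.exp (p * (j + 1)) * b j),
    ENNReal.add_ne_top.2 ⟨ENNReal.one_ne_top, hsum.tsum_ofReal_ne_top⟩, fun N => ?_⟩
  have hms : ∀ j : ℕ, MeasurableSet {g | (j : ℝ) ≤ -energy m N g} := fun j =>
    measurableSet_le measurable_const (measurable_energy m N).neg
  -- Discrete layer cake: for a positive value of -G_N, the term with j = ⌊-G_N⌋ alone dominates.
  have hpt : ∀ g, ENNReal.ofReal (Real.exp (p * -energy m N g)) ≤ 1 + ∑' j : ℕ,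
      {g | (j : ℝ) ≤ -energy m N g}.indicator
        (fun _ => ENNReal.ofReal (Real.exp (p * (j + 1)))) g := by
    intro g
    rcases le_or_gt (-energy m N g) 0 with hg | hg
    · refine le_trans ?_ le_self_add
      rw [ENNReal.ofReal_le_one, Real.exp_le_one_iff]
      exact mul_nonpos_of_nonneg_of_nonpos hp hg
    · refine le_trans ?_ le_add_self
      refine le_trans ?_ (ENNReal.le_tsum ⌊-energy m N g⌋₊)
      rw [Set.indicator_of_mem (by exact Nat.floor_le hg.le)]
      refine ENNReal.ofReal_le_ofReal (Real.exp_le_exp.2 ?_)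
      exact mul_le_mul_of_nonneg_left (Nat.lt_floor_add_one _).le hp
  refine (lintegral_mono hpt).trans ?_
  rw [lintegral_add_left measurable_const, lintegral_const, measure_univ, mul_one,
    lintegral_tsum fun j => (measurable_const.indicator (hms j)).aemeasurable]
  refine add_le_add_right (ENNReal.tsum_le_tsum fun j => ?_) _
  rw [lintegral_indicator_const (hms j), ENNReal.ofReal_mul (Real.exp_pos _).le]
  exact mul_le_mul_right (hbm j N) _

/-! ### Convergence of the Boltzmann factors -/

/-- The Boltzmann factor of the truncated energy, as a function of the modes. -/
def boltzmann (m N : ℕ) (g : Freq → ℂ) : ℝ := Real.exp (-energy m N g)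

theorem measurable_boltzmann (m N : ℕ) : Measurable (boltzmann m N) :=
  Real.measurable_exp.comp (measurable_energy m N).neg

theorem exists_eLpNorm_boltzmann_le {m : ℕ} (hm : 2 ≤ m) {p : ℝ≥0∞} (hp0 : p ≠ 0) (hp : p ≠ ∞) :
    ∃ K : ℝ≥0, ∀ N, eLpNorm (boltzmann m N) p gaussianFamily ≤ K := by
  obtain ⟨K, hK, h⟩ := exists_lintegral_exp_neg_energy_le hm p.toReal ENNReal.toReal_nonneg
  have hK' : K ^ (1 / p.toReal) ≠ ∞ := ENNReal.rpow_ne_top_of_nonneg (by positivity) hK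
  refine ⟨(K ^ (1 / p.toReal)).toNNReal, fun N => ?_⟩
  rw [ENNReal.coe_toNNReal hK', eLpNorm_eq_lintegral_rpow_enorm_toReal hp0 hp]
  refine ENNReal.rpow_le_rpow ((le_of_eq ?_).trans (h N)) (by positivity)
  refine lintegral_congr fun g => ?_
  rw [boltzmann, ← ofReal_norm, Real.norm_of_nonneg (Real.exp_pos _).le,
    ENNReal.ofReal_rpow_of_pos (Real.exp_pos _), ← Real.exp_mul, mul_comm]

/-- On a probability space it suffices to treat an even integer exponent 2k ≥ p. -/
theorem exists_eLpNorm_energy_sub_le {m : ℕ} (hm : 0 < m) {p : ℝ≥0∞} (hp : p ≠ ∞) :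
    ∃ δ : ℕ → ℝ≥0∞, Tendsto δ atTop (𝓝 0) ∧ (∀ M, δ M ≠ ∞) ∧ ∀ M N : ℕ, M ≤ N →
      eLpNorm (energy m N - energy m M) p gaussianFamily ≤ δ M := by
  obtain ⟨C, hC, h⟩ := exists_lintegral_energy_sub_pow_le hm
  obtain ⟨k, hk⟩ := ENNReal.exists_nat_gt hp
  have hk0 : 0 < k := by
    rcases Nat.eq_zero_or_pos k with rfl | h0
    · simp at hk
    · exact h0
  have hk' : (0 : ℝ) < k := by exact_mod_cast hk0
  have hle : p ≤ ((2 * k : ℕ) : ℝ≥0∞) := hk.le.trans (by exact_mod_cast (by omega))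
  have he : 0 < 1 / ((2 * k : ℕ) : ℝ) := by positivity
  refine ⟨fun M => ENNReal.ofReal ((2 * m * k).factorial * (C / ((M : ℝ) + 1)) ^ k)
    ^ (1 / ((2 * k : ℕ) : ℝ)), ?_, fun M => ?_, fun M N hMN => ?_⟩
  · have h1 : Tendsto (fun M : ℕ => (2 * m * k).factorial * (C / ((M : ℝ) + 1)) ^ k) atTop
        (𝓝 ((2 * m * k).factorial * 0 ^ k)) :=
      ((tendsto_const_nhds.div_atTop (tendsto_natCast_atTop_atTop.atTop_add
        tendsto_const_nhds)).pow k).const_mul _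
    have h2 := (ENNReal.continuous_rpow_const (y := 1 / ((2 * k : ℕ) : ℝ))).tendsto _ |>.comp
      (ENNReal.tendsto_ofReal h1)
    rw [zero_pow hk0.ne', mul_zero, ENNReal.ofReal_zero, ENNReal.zero_rpow_of_pos he] at h2
    exact h2
  · exact ENNReal.rpow_ne_top_of_nonneg he.le ENNReal.ofReal_ne_top
  · have hmeas : AEStronglyMeasurable (energy m N - energy m M) gaussianFamily :=
      ((measurable_energy m N).sub (measurable_energy m M)).aestronglyMeasurable
    refine (eLpNorm_le_eLpNorm_of_exponent_le hle hmeas).trans ?_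
    rw [eLpNorm_eq_lintegral_rpow_enorm_toReal (by exact_mod_cast (by omega))
      (ENNReal.natCast_ne_top _)]
    simp only [ENNReal.toReal_natCast, ENNReal.rpow_natCast]
    exact ENNReal.rpow_le_rpow (h M N hMN k) he.le

theorem abs_exp_neg_sub_exp_neg_le (a b : ℝ) :
    |Real.exp (-a) - Real.exp (-b)| ≤ |a - b| * (Real.exp (-a) + Real.exp (-b)) := by
  have key : ∀ a b : ℝ, a ≤ b →
      |Real.exp (-a) - Real.exp (-b)| ≤ |a - b| * (Real.exp (-a) + Real.exp (-b)) := by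
    intro a b hab
    have h1 : Real.exp (-b) ≤ Real.exp (-a) := Real.exp_le_exp.2 (by linarith)
    rw [abs_of_nonneg (by linarith), abs_sub_comm, abs_of_nonneg (by linarith)]
    have h2 : Real.exp (-b) = Real.exp (-a) * Real.exp (a - b) := by
      rw [← Real.exp_add]
      congr 1
      ring
    have h3 := Real.add_one_le_exp (a - b)
    have h4 := Real.exp_pos (-a)
    have h5 := Real.exp_pos (-b)
    nlinarith [mul_nonneg (sub_nonneg.2 hab) h5.le]
  rcases le_total a b with h | h
  · exact key a b h
  · rw [abs_sub_comm, abs_sub_comm a, add_comm]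
    exact key b a h

/-- Hölder with 1/p = 1/(2p) + 1/(2p): the energy difference is small in L^{2p} and the Boltzmann
factors are bounded there. -/
theorem exists_eLpNorm_boltzmann_sub_le {m : ℕ} (hm : 2 ≤ m) {p : ℝ≥0∞} (hp1 : 1 ≤ p)
    (hp : p ≠ ∞) :
    ∃ δ : ℕ → ℝ≥0∞, Tendsto δ atTop (𝓝 0) ∧ ∀ M N : ℕ, M ≤ N →
      eLpNorm (boltzmann m N - boltzmann m M) p gaussianFamily ≤ δ M := by
  have hp0 : p ≠ 0 := (zero_lt_one.trans_le hp1).ne'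
  have h2p : 2 * p ≠ ∞ := ENNReal.mul_ne_top (by simp) hp
  obtain ⟨δ, hδ, -, h⟩ := exists_eLpNorm_energy_sub_le (m := m) (by omega) h2p
  obtain ⟨K, hK⟩ := exists_eLpNorm_boltzmann_le hm (p := 2 * p) (by simp [hp0]) h2p
  have : ENNReal.HolderTriple (2 * p) (2 * p) p := ⟨by
    rw [ENNReal.mul_inv (by simp) (by simp), ← add_mul, ENNReal.inv_two_add_inv_two, one_mul]⟩
  refine ⟨fun M => δ M * (K + K), ?_, fun M N hMN => ?_⟩
  · have := ENNReal.Tendsto.mul_const hδ (b := (K : ℝ≥0∞) + K) (Or.inr (by simp))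
    simpa using this
  · have hbm := fun N => (measurable_boltzmann m N).aestronglyMeasurable (μ := gaussianFamily)
    have h1 : eLpNorm (boltzmann m N - boltzmann m M) p gaussianFamily
        ≤ eLpNorm ((energy m N - energy m M) • (boltzmann m N + boltzmann m M)) p
          gaussianFamily := by
      refine eLpNorm_mono fun g => ?_
      simp only [Pi.sub_apply, Pi.smul_apply', Pi.add_apply, Real.norm_eq_abs, smul_eq_mul]
      rw [abs_mul, abs_of_nonneg (a := boltzmann m N g + boltzmann m M g)
        (add_nonneg (Real.exp_pos _).le (Real.exp_pos _).le)]
      exact abs_exp_neg_sub_exp_neg_le _ _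
    refine h1.trans ((eLpNorm_smul_le_mul_eLpNorm (p := 2 * p) (q := 2 * p)
      ((hbm N).add (hbm M)) ((measurable_energy m N).sub
        (measurable_energy m M)).aestronglyMeasurable).trans ?_)
    refine mul_le_mul' (h M N hMN) ((eLpNorm_add_le (hbm N) (hbm M) ?_).trans
      (add_le_add (hK N) (hK M)))
    exact hp1.trans (le_mul_of_one_le_left' (by norm_num))

/-- Along a subsequence the truncated energies converge almost everywhere. -/
theorem exists_tendsto_energy {m : ℕ} (hm : 0 < m) :
    ∃ G : (Freq → ℂ) → ℝ, Measurable G ∧ ∃ ns : ℕ → ℕ, Tendsto ns atTop atTop ∧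
      ∀ᵐ g ∂gaussianFamily, Tendsto (fun i => energy m (ns i) g) atTop (𝓝 (G g)) := by
  obtain ⟨δ, hδ, hδt, h⟩ := exists_eLpNorm_energy_sub_le hm (p := 2) (by simp)
  have hB : ∀ i : ℕ, 0 < (2⁻¹ : ℝ≥0∞) ^ i := fun i => ENNReal.pow_pos (by simp) i
  obtain ⟨φ, hφ, hφ'⟩ := extraction_forall_of_eventually'
    (P := fun i k => ∀ M, k ≤ M → δ M < (2⁻¹ : ℝ≥0∞) ^ i) fun i => by
      obtain ⟨k, hk⟩ := eventually_atTop.1 (hδ.eventually_lt_const (hB i))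
      exact ⟨k, fun k' hk' M hM => hk M (hk'.trans hM)⟩
  have hEm := fun N => (measurable_energy m N).aestronglyMeasurable (μ := gaussianFamily)
  -- Only differences of energies are controlled in L², so completeness is applied after subtracting
  -- the energy at cutoff 0.
  have hf : ∀ i, MemLp (energy m (φ i) - energy m 0) 2 gaussianFamily := fun i =>
    ⟨(hEm _).sub (hEm _), (h 0 (φ i) (Nat.zero_le _)).trans_lt (hδt 0).lt_top⟩
  have hsum : ∑' i : ℕ, (2⁻¹ : ℝ≥0∞) ^ i ≠ ∞ := by
    rw [ENNReal.tsum_geometric]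
    simp
  have hcau : ∀ N n k : ℕ, N ≤ n → N ≤ k →
      eLpNorm ((energy m (φ n) - energy m 0) - (energy m (φ k) - energy m 0)) 2 gaussianFamily
        < (2⁻¹ : ℝ≥0∞) ^ N := by
    intro N n k hn hk
    rw [sub_sub_sub_cancel_right]
    rcases le_total n k with hnk | hnk
    · rw [eLpNorm_sub_comm]
      exact (h _ _ (hφ.monotone hnk)).trans_lt (hφ' N _ (hφ.monotone hn))
    · exact (h _ _ (hφ.monotone hnk)).trans_lt (hφ' N _ (hφ.monotone hk))
  obtain ⟨F, hF, hlim⟩ := Lp.cauchy_complete_eLpNorm (by norm_num) hf hsum hcau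
  obtain ⟨ψ, hψ, hae⟩ := (tendstoInMeasure_of_tendsto_eLpNorm (by norm_num)
    (fun i => (hf i).1) hF.1 hlim).exists_seq_tendsto_ae
  refine ⟨fun g => hF.1.mk F g + energy m 0 g, hF.1.stronglyMeasurable_mk.measurable.add
    (measurable_energy m 0), fun i => φ (ψ i), hφ.tendsto_atTop.comp hψ.tendsto_atTop, ?_⟩
  filter_upwards [hae, hF.1.ae_eq_mk] with g hg hg'
  rw [← hg']
  have := hg.add_const (energy m 0 g)
  simpa using this

theorem liminf_le_of_eventually_le {u : ℕ → ℝ≥0∞} {c : ℝ≥0∞} (h : ∀ᶠ i in atTop, u i ≤ c) :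
    liminf u atTop ≤ c :=
  (liminf_le_liminf h).trans (le_of_eq (liminf_const c))

/-- The Boltzmann factors converge in every `L^p` to a common positive limit. -/
theorem exists_tendsto_boltzmann {m : ℕ} (hm : 2 ≤ m) :
    ∃ R : (Freq → ℂ) → ℝ, (∀ g, 0 < R g) ∧ ∀ p : ℝ≥0∞, 1 ≤ p → p ≠ ∞ →
      MemLp R p gaussianFamily ∧
        Tendsto (fun N => eLpNorm (boltzmann m N - R) p gaussianFamily) atTop (𝓝 0) := by
  obtain ⟨G, hG, ns, hns, hae⟩ := exists_tendsto_energy (m := m) (by omega)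
  have hbm := fun N => (measurable_boltzmann m N).aestronglyMeasurable (μ := gaussianFamily)
  have hR : Measurable fun g => Real.exp (-G g) := Real.measurable_exp.comp hG.neg
  have hRae : ∀ᵐ g ∂gaussianFamily,
      Tendsto (fun i => boltzmann m (ns i) g) atTop (𝓝 (Real.exp (-G g))) := by
    filter_upwards [hae] with g hg
    exact (Real.continuous_exp.tendsto _).comp hg.neg
  -- Taking the limit on the level of energies makes it independent of p and strictly positive
  -- everywhere.
  refine ⟨fun g => Real.exp (-G g), fun g => Real.exp_pos _, fun p hp1 hp => ?_⟩
  have hp0 : p ≠ 0 := (zero_lt_one.trans_le hp1).ne'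
  obtain ⟨K, hK⟩ := exists_eLpNorm_boltzmann_le hm hp0 hp
  obtain ⟨δ, hδ, h⟩ := exists_eLpNorm_boltzmann_sub_le hm hp1 hp
  refine ⟨⟨hR.aestronglyMeasurable, ?_⟩, ?_⟩
  · exact (((Lp.eLpNorm_lim_le_liminf_eLpNorm (fun i => hbm (ns i)) _ hRae)).trans
      (liminf_le_of_eventually_le (Eventually.of_forall fun i => hK (ns i)))).trans_lt
        ENNReal.coe_lt_top
  · refine tendsto_of_tendsto_of_tendsto_of_le_of_le tendsto_const_nhds hδ
      (fun _ => zero_le) fun N => ?_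
    -- Fatou along the subsequence in the second index turns the Cauchy estimate into convergence of
    -- the whole sequence.
    refine (Lp.eLpNorm_lim_le_liminf_eLpNorm (f := fun i => boltzmann m N - boltzmann m (ns i))
      (fun i => (hbm N).sub (hbm (ns i))) _ ?_).trans (liminf_le_of_eventually_le ?_)
    · filter_upwards [hRae] with g hg
      exact hg.const_sub _
    · filter_upwards [hns.eventually_ge_atTop N] with i hi
      rw [eLpNorm_sub_comm]
      exact h N (ns i) hi

/-! ### Transfer to the Sobolev space -/

/-- The modes `⟨n⟩ û(n)` of an element of the Sobolev space. -/
def modes {s : ℝ} (u : Sobolev s) (n : Freq) : ℂ := bracket n * u.coeff n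

/-- The density depends on u only through its modes, whose law does not involve s; hence the
constants are uniform in s. -/
theorem measurePreserving_modes_gff {s : ℝ} (hs : s < 0) :
    MeasurePreserving (modes : Sobolev s → Freq → ℂ) (gff s) gaussianFamily := by
  have hc : Measurable (Sobolev.coeff : Sobolev s → Freq → ℂ) :=
    measurable_pi_lambda _ fun n => (continuous_coeff s n).measurable
  have hb : Measurable fun (a : Freq → ℂ) n => (bracket n : ℂ) * a n := by fun_prop
  refine ⟨hb.comp hc, ?_⟩
  have h1 : (modes : Sobolev s → Freq → ℂ)
      = (fun (a : Freq → ℂ) n => (bracket n : ℂ) * a n) ∘ Sobolev.coeff := rfl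
  have h2 : (fun (a : Freq → ℂ) n => (bracket n : ℂ) * a n) ∘ (fun g n => g n / (bracket n : ℂ))
      = id := by
    funext g n
    have : (bracket n : ℂ) ≠ 0 := by exact_mod_cast (bracket_pos n).ne'
    simp only [Function.comp_apply, id_eq]
    field_simp
  rw [h1, ← Measure.map_map hb hc, map_coeff_gff hs, Measure.map_map hb (by fun_prop), h2,
    Measure.map_id]

theorem proj_eq_field {s : ℝ} (N : ℕ) (u : Sobolev s) (x : Torus) :
    proj N u x = field N (modes u) x := by
  refine Finset.sum_congr rfl fun n _ => ?_
  have : (bracket n : ℂ) ≠ 0 := by exact_mod_cast (bracket_pos n).ne'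
  rw [modes]
  field_simp

theorem density_eq_boltzmann {s : ℝ} (m N : ℕ) :
    (density m N : Sobolev s → ℝ) = boltzmann m N ∘ modes := by
  funext u
  simp only [density, boltzmann, wickEnergy, energy, Function.comp_apply, wickPower, wickPoly,
    proj_eq_field]

theorem isProbabilityMeasure_gibbs {s : ℝ} {R : Sobolev s → ℝ} (hR : Integrable R (gff s))
    (h0 : 0 ≤ᵐ[gff s] R) (hpos : 0 < ∫ u, R u ∂(gff s)) : IsProbabilityMeasure (gibbs R) := by
  refine ⟨?_⟩
  rw [gibbs, Measure.smul_apply, smul_eq_mul, withDensity_apply _ MeasurableSet.univ,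
    Measure.restrict_univ, ← ofReal_integral_eq_lintegral_ofReal hR h0]
  exact ENNReal.inv_mul_cancel (ENNReal.ofReal_pos.2 hpos).ne' ENNReal.ofReal_ne_top

end WickNLS

end

theorem proposition1p2 (m : ℕ) (hm : 2 ≤ m) :
    (∀ p : ℝ≥0∞, 1 ≤ p → p ≠ ∞ → ∃ C : ℝ≥0, ∀ s : ℝ, s < 0 → ∀ N : ℕ,
      MemLp (WickNLS.density m N) p (WickNLS.gff s) ∧
        eLpNorm (WickNLS.density m N) p (WickNLS.gff s) ≤ C) ∧
    ∀ s : ℝ, s < 0 → ∃ R : WickNLS.Sobolev s → ℝ,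
      (∀ p : ℝ≥0∞, 1 ≤ p → p ≠ ∞ →
        MemLp R p (WickNLS.gff s) ∧
          Tendsto (fun N => eLpNorm (WickNLS.density m N - R) p (WickNLS.gff s)) atTop (𝓝 0)) ∧
      0 ≤ᵐ[WickNLS.gff s] R ∧
      0 < ∫ u, R u ∂(WickNLS.gff s) ∧
      IsProbabilityMeasure (WickNLS.gibbs R) := by
  constructor
  · intro p hp1 hp
    obtain ⟨K, hK⟩ := WickNLS.exists_eLpNorm_boltzmann_le hm (zero_lt_one.trans_le hp1).ne' hp
    refine ⟨K, fun s hs N => ?_⟩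
    have hΨ := WickNLS.measurePreserving_modes_gff hs
    have hmeas := (WickNLS.measurable_boltzmann m N).aestronglyMeasurable
      (μ := WickNLS.gaussianFamily)
    have hle : eLpNorm (WickNLS.density m N) p (WickNLS.gff s) ≤ K := by
      rw [WickNLS.density_eq_boltzmann, eLpNorm_comp_measurePreserving hmeas hΨ]
      exact hK N
    refine ⟨⟨?_, hle.trans_lt ENNReal.coe_lt_top⟩, hle⟩
    rw [WickNLS.density_eq_boltzmann]
    exact hmeas.comp_measurePreserving hΨ
  · intro s hs
    have hΨ := WickNLS.measurePreserving_modes_gff hs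
    obtain ⟨R, hR0, hR⟩ := WickNLS.exists_tendsto_boltzmann hm
    have hint : Integrable (R ∘ WickNLS.modes) (WickNLS.gff s) :=
      memLp_one_iff_integrable.1 ((hR 1 le_rfl (by simp)).1.comp_measurePreserving hΨ)
    have h0 : ∀ u, 0 < (R ∘ WickNLS.modes (s := s)) u := fun u => hR0 _
    have hnn : 0 ≤ᵐ[WickNLS.gff s] (R ∘ WickNLS.modes) := ae_of_all _ fun u => (h0 u).le
    have hpos : 0 < ∫ u, (R ∘ WickNLS.modes) u ∂(WickNLS.gff s) := by
      rw [integral_pos_iff_support_of_nonneg_ae hnn hint]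
      have : Function.support (R ∘ WickNLS.modes (s := s)) = Set.univ :=
        Set.eq_univ_of_forall fun u => (h0 u).ne'
      rw [this, measure_univ]
      exact one_pos
    refine ⟨R ∘ WickNLS.modes, fun p hp1 hp => ⟨(hR p hp1 hp).1.comp_measurePreserving hΨ, ?_⟩,
      hnn, hpos, WickNLS.isProbabilityMeasure_gibbs hint hnn hpos⟩
    refine (hR p hp1 hp).2.congr fun N => ?_
    rw [WickNLS.density_eq_boltzmann, ← eLpNorm_comp_measurePreserving
      ((WickNLS.measurable_boltzmann m N).aestronglyMeasurable.sub (hR p hp1 hp).1.1) hΨ]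
    rfl
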